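/- Let $n\geq 4$ and let $S$ be a set of $n$ points in Euclidean space $\mathbb{R}^3$, with diameter $D=\max_{x,y\in S}\|x-y\|$. The diameter graph of $S$ is the graph with vertex set $S$ in which two distinct points $x,y$ are joined by an edge if and only if $\|x-y\|=D$. Then the diameter graph of $S$ has at most $2n-2$ edges. -/

import Mathlib

/-- The diameter graph on a finite set `S` of points of Euclidean `d`-space: its vertices are the
points of `S`, and two distinct points are joined when their distance is the diameter of `S`. -/
def diameterGraph {d : ℕ} (S : Finset (EuclideanSpace ℝ (Fin d))) : SimpleGraph S where
  Adj x y := x ≠ y ∧ dist x y = Metric.diam (S : Set (EuclideanSpace ℝ (Fin d)))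
  symm := ⟨fun x y h => ⟨h.1.symm, by rw [dist_comm]; exact h.2⟩⟩
  loopless := ⟨fun _ h => h.1 rfl⟩

/-! Give every point `x` of `S` a red cone, spanned by the vectors `y - x` over all diameters `xy`,
and the opposite blue cone. The red cone of `x` and the blue cone of `y` touch along the ray of `y -
x` when `xy` is a diameter; apart from such rays, distinct cones do not cross
(`diamCone_noncrossing`). Seen from the origin this is a planar arrangement of `2n` spherical
polygons whose contacts are the ordered diameter pairs. It thus suffices to show that there are at
most `4n - 4` contacts.

Instead of Euler's formula the proof sweeps a half plane once around a generic axis. The cones that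
it meets are ordered vertically, and non-crossing makes the order of two cones the same wherever
both are met. The potential adds, over vertically consecutive cones, `1` for a contact ahead and
`-1` for a contact already passed. Passing a contact raises it by at most `2m - 2`, where `m` counts
the starts and ends of the two touching cones there (`potential_sub_le`). A full turn restores the
potential, so there are at most as many contacts as starts and ends (`card_le_sum_marks`).

A cone has at most one start and one end, and none if it surrounds the axis. If every point has at
least three diameters, three diameter vectors at a point `x` are linearly independent; an axis
through the interior of their span as a cone is surrounded by both cones of `x`. This leaves `2n -
2` cones and at most `2(2n - 2)` contacts. A point with at most two diameters is removed by
induction. -/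

/-- The planar cross product. -/
def planeCross (a b : ℝ × ℝ) : ℝ := a.1 * b.2 - a.2 * b.1

lemma planeCross_swap (a b : ℝ × ℝ) : planeCross a b = -planeCross b a := by
  simp only [planeCross]; ring

lemma planeCross_self (a : ℝ × ℝ) : planeCross a a = 0 := by
  simp only [planeCross]; ring

lemma planeCross_neg_left (a b : ℝ × ℝ) : planeCross (-a) b = -planeCross a b := by
  simp only [planeCross, Prod.fst_neg, Prod.snd_neg]; ring

lemma planeCross_neg_right (a b : ℝ × ℝ) : planeCross a (-b) = -planeCross a b := by
  simp only [planeCross, Prod.fst_neg, Prod.snd_neg]; ring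

/-! ### Touching cones and their vertical order around an axis. -/

/-- A family of convex cones, indexed by `P`, in a real vector space with coordinates `α`, `β`, `η`,
whose members are coloured red or blue and touch along rays `vec u`, one for each `u : ι`.
The coordinates are generic with respect to the contact rays. -/
structure ContactSystem (ι P E : Type*) [AddCommGroup E] [Module ℝ E] where
  vec : ι → E
  red : ι → P
  blue : ι → P
  K : P → PointedCone ℝ E
  α : E →ₗ[ℝ] ℝ
  β : E →ₗ[ℝ] ℝ
  η : E →ₗ[ℝ] ℝ
  vec_mem_red : ∀ u, vec u ∈ K (red u)
  vec_mem_blue : ∀ u, vec u ∈ K (blue u)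
  red_ne_blue : ∀ u v, red u ≠ blue v
  eq_of_contact : ∀ u v, red u = red v → blue u = blue v → u = v
  eq_zero_of_coords : ∀ z, α z = 0 → β z = 0 → η z = 0 → z = 0
  α_vec_ne : ∀ u, α (vec u) ≠ 0
  opp : ∀ u, ∃ v, vec v = -vec u
  generic : ∀ u v, u ≠ v → α (vec u) * β (vec v) = β (vec u) * α (vec v) → vec v = -vec u
  salient : ∀ X, ∀ a ∈ K X, ∀ b ∈ K X, a + b = 0 → a = 0
  noncrossing : ∀ X Y, X ≠ Y → ∀ a ∈ K X, ∀ a' ∈ K X, ∀ b ∈ K Y, ∀ b' ∈ K Y,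
    a ≠ 0 → a' ≠ 0 → b ≠ 0 → b' ≠ 0 → a + a' = b + b' →
    ∃ u, (red u = X ∧ blue u = Y ∨ red u = Y ∧ blue u = X) ∧ ∃ t : ℝ, 0 ≤ t ∧
      (a = t • vec u ∨ a' = t • vec u ∨ b = t • vec u ∨ b' = t • vec u)
  no_polar : ∀ u, ∀ a ∈ K (red u), ∀ b ∈ K (blue u), a ≠ 0 → b ≠ 0 →
    α a = 0 → β a = 0 → α b = 0 → β b = 0 → False

namespace ContactSystem

variable {ι P E : Type*} [AddCommGroup E] [Module ℝ E] (C : ContactSystem ι P E)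

/-- The direction of a contact ray in the `αβ`-plane. -/
def dir (u : ι) : ℝ × ℝ := (C.α (C.vec u), C.β (C.vec u))

/-- The ray `u` is a vertex of the cone `X`. -/
def Mem (X : P) (u : ι) : Prop := C.red u = X ∨ C.blue u = X

/-- The ray `u` is the contact of the cones `X` and `Y`. -/
def Contact (X Y : P) (u : ι) : Prop := C.red u = X ∧ C.blue u = Y ∨ C.red u = Y ∧ C.blue u = X

/-- The half plane over the direction `d` meets the cone `X` between two of its vertices. -/
def Alive (X : P) (d : ℝ × ℝ) : Prop :=
  ∃ v v', C.Mem X v ∧ C.Mem X v' ∧ 0 < planeCross (C.dir v) d ∧ 0 < planeCross d (C.dir v') ∧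
    0 < planeCross (C.dir v) (C.dir v')

/-- The first vertex of a cone in the counterclockwise sweep. -/
def IsStart (X : P) (u : ι) : Prop :=
  C.Mem X u ∧ ∀ v, C.Mem X v → v ≠ u → 0 < planeCross (C.dir u) (C.dir v)

/-- The last vertex of a cone in the counterclockwise sweep. -/
def IsEnd (X : P) (u : ι) : Prop :=
  C.Mem X u ∧ ∀ v, C.Mem X v → v ≠ u → planeCross (C.dir u) (C.dir v) < 0

/-- The point `z` lies over the direction `d`. -/
def Over (z : E) (d : ℝ × ℝ) : Prop := C.α z = d.1 ∧ C.β z = d.2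

/-- No contact of `X` and `Y` has direction `d`. -/
def Apart (X Y : P) (d : ℝ × ℝ) : Prop :=
  d ≠ 0 ∧ ∀ u, C.Contact X Y u → ∀ t : ℝ, 0 ≤ t → d ≠ t • C.dir u

/-- No contact ray is parallel to the direction `d`. -/
def Regular (d : ℝ × ℝ) : Prop := d ≠ 0 ∧ ∀ u, planeCross (C.dir u) d ≠ 0

variable {C}

lemma Mem.vec_mem {X : P} {u : ι} (h : C.Mem X u) : C.vec u ∈ C.K X := by
  rcases h with rfl | rfl
  · exact C.vec_mem_red u
  · exact C.vec_mem_blue u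

lemma Contact.symm {X Y : P} {u : ι} (h : C.Contact X Y u) : C.Contact Y X u := Or.symm h

lemma Contact.mem_left {X Y : P} {u : ι} (h : C.Contact X Y u) : C.Mem X u := by
  rcases h with h | h
  · exact Or.inl h.1
  · exact Or.inr h.2

lemma Contact.mem_right {X Y : P} {u : ι} (h : C.Contact X Y u) : C.Mem Y u := h.symm.mem_left

lemma Contact.unique {X Y : P} {u v : ι} (h : C.Contact X Y u) (h' : C.Contact X Y v) : u = v := by
  rcases h with h | h <;> rcases h' with h' | h'
  · exact C.eq_of_contact u v (h.1.trans h'.1.symm) (h.2.trans h'.2.symm)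
  · exact absurd (h.1.trans h'.2.symm) (C.red_ne_blue u v)
  · exact absurd (h.1.trans h'.2.symm) (C.red_ne_blue u v)
  · exact C.eq_of_contact u v (h.1.trans h'.1.symm) (h.2.trans h'.2.symm)

lemma vec_ne_zero (u : ι) : C.vec u ≠ 0 := fun h => C.α_vec_ne u (by rw [h, map_zero])

lemma Mem.not_opp {X : P} {u v : ι} (hu : C.Mem X u) (hv : C.Mem X v) : C.vec v ≠ -C.vec u := by
  intro h
  exact C.vec_ne_zero u (C.salient X _ hu.vec_mem _ hv.vec_mem (by rw [h, add_neg_cancel]))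

lemma planeCross_dir_ne {u v : ι} (h : u ≠ v) (h' : C.vec v ≠ -C.vec u) :
    planeCross (C.dir u) (C.dir v) ≠ 0 := by
  intro h0
  refine h' (C.generic u v h ?_)
  simp only [planeCross, dir] at h0
  linarith

lemma dir_ne_zero (u : ι) : C.dir u ≠ 0 := fun h => C.α_vec_ne u (congrArg Prod.fst h)

lemma Regular.apart {d : ℝ × ℝ} (h : C.Regular d) (X Y : P) : C.Apart X Y d := by
  refine ⟨h.1, fun u _ t _ e => h.2 u ?_⟩
  rw [e]
  simp only [planeCross, Prod.smul_fst, Prod.smul_snd, smul_eq_mul]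
  ring

lemma apart_dir {X Y : P} {u : ι} (h : ¬ C.Contact X Y u) : C.Apart X Y (C.dir u) := by
  refine ⟨C.dir_ne_zero u, fun v hv t ht e => ?_⟩
  have huv : u ≠ v := by rintro rfl; exact h hv
  have e1 := congrArg Prod.fst e
  have e2 := congrArg Prod.snd e
  simp only [dir, Prod.smul_fst, Prod.smul_snd, smul_eq_mul] at e1 e2
  have := C.generic u v huv (by rw [e1, e2]; ring)
  rw [this, map_neg] at e1
  have h0 : (1 + t) * C.α (C.vec u) = 0 := by linarith
  rcases mul_eq_zero.1 h0 with h1 | h1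
  · linarith
  · exact C.α_vec_ne u h1

lemma Alive.exists_over {X : P} {d : ℝ × ℝ} (h : C.Alive X d) : ∃ z ∈ C.K X, C.Over z d := by
  obtain ⟨v, v', hv, hv', h1, h2, h3⟩ := h
  -- The coefficients are those of `d` in terms of the two directions, by Cramer's rule.
  refine ⟨(planeCross d (C.dir v') / planeCross (C.dir v) (C.dir v')) • C.vec v +
    (planeCross (C.dir v) d / planeCross (C.dir v) (C.dir v')) • C.vec v',
    add_mem ((C.K X).smul_mem (by positivity) hv.vec_mem)
      ((C.K X).smul_mem (by positivity) hv'.vec_mem), ?_, ?_⟩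
  all_goals
    simp only [map_add, map_smul, smul_eq_mul]
    field_simp
    simp only [planeCross, dir]
    ring

lemma Over.ne_zero {z : E} {d : ℝ × ℝ} (h : C.Over z d) (hd : d ≠ 0) : z ≠ 0 := by
  rintro rfl
  refine hd (Prod.ext ?_ ?_)
  · rw [← h.1, map_zero]; rfl
  · rw [← h.2, map_zero]; rfl

lemma Over.eq_of_height {z z' : E} {d : ℝ × ℝ} (h : C.Over z d) (h' : C.Over z' d)
    (he : C.η z = C.η z') : z = z' := by
  refine sub_eq_zero.1 (C.eq_zero_of_coords _ ?_ ?_ ?_)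
  · rw [map_sub, h.1, h'.1, sub_self]
  · rw [map_sub, h.2, h'.2, sub_self]
  · rw [map_sub, he, sub_self]

lemma Apart.ne_smul {X Y : P} {d : ℝ × ℝ} (h : C.Apart X Y d) {u : ι} (hu : C.Contact X Y u)
    {z : E} (hz : C.Over z d) {s t : ℝ} (hs : 0 < s) (ht : 0 ≤ t) : s • z ≠ t • C.vec u := by
  intro e
  refine h.2 u hu (s⁻¹ * t) (by positivity) ?_
  have e' : z = (s⁻¹ * t) • C.vec u := by
    rw [mul_smul, ← e, smul_smul, inv_mul_cancel₀ hs.ne', one_smul]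
  refine Prod.ext ?_ ?_
  · rw [← hz.1, e']; simp [dir]
  · rw [← hz.2, e']; simp [dir]

/-- Two distinct cones are in the same vertical order over any two directions without contact. -/
lemma height_lt_of_height_le {X Y : P} (hXY : X ≠ Y) {d d' : ℝ × ℝ} (hd : C.Apart X Y d)
    (hd' : C.Apart X Y d') {a a' b b' : E} (ha : a ∈ C.K X) (ha' : a' ∈ C.K X) (hb : b ∈ C.K Y)
    (hb' : b' ∈ C.K Y) (oa : C.Over a d) (ob : C.Over b d) (oa' : C.Over a' d')
    (ob' : C.Over b' d') (h : C.η b ≤ C.η a) : C.η b' < C.η a' := by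
  -- Equal positive combinations would be a crossing, hence one of the four vectors would lie on a
  -- contact ray, against `Apart`.
  have key : ∀ s s' : ℝ, 0 < s → 0 < s' → s • a + s' • a' = s • b + s' • b' → False := by
    intro s s' hs hs' e
    obtain ⟨u, hu, t, ht, h4⟩ := C.noncrossing X Y hXY _ ((C.K X).smul_mem hs.le ha)
      _ ((C.K X).smul_mem hs'.le ha') _ ((C.K Y).smul_mem hs.le hb) _
      ((C.K Y).smul_mem hs'.le hb') (smul_ne_zero hs.ne' (oa.ne_zero hd.1))
      (smul_ne_zero hs'.ne' (oa'.ne_zero hd'.1)) (smul_ne_zero hs.ne' (ob.ne_zero hd.1))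
      (smul_ne_zero hs'.ne' (ob'.ne_zero hd'.1)) e
    rcases h4 with h4 | h4 | h4 | h4
    · exact hd.ne_smul hu oa hs ht h4
    · exact hd'.ne_smul hu oa' hs' ht h4
    · exact hd.ne_smul hu ob hs ht h4
    · exact hd'.ne_smul hu ob' hs' ht h4
  -- With all four vectors equal, non-crossing says that the cones are disjoint over `d`.
  have same : ∀ (d : ℝ × ℝ), C.Apart X Y d → ∀ a ∈ C.K X, ∀ b ∈ C.K Y, C.Over a d → C.Over b d →
      a ≠ b := by
    rintro d hd a ha _ hb oa ob rfl
    obtain ⟨u, hu, t, ht, h4⟩ := C.noncrossing X Y hXY a ha a ha a hb a hb (oa.ne_zero hd.1)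
      (oa.ne_zero hd.1) (oa.ne_zero hd.1) (oa.ne_zero hd.1) rfl
    simp only [or_self] at h4
    exact hd.ne_smul hu oa one_pos ht (by rw [one_smul, h4])
  by_contra hlt
  rw [not_lt] at hlt
  rcases h.eq_or_lt with h | h
  · exact same d hd a ha b hb oa ob (oa.eq_of_height ob h.symm)
  rcases hlt.eq_or_lt with hlt | hlt
  · exact same d' hd' a' ha' b' hb' oa' ob' (oa'.eq_of_height ob' hlt)
  -- The weights are the two height gaps, so that the heights balance; the other coordinates agree
  -- since the points lie over the same directions.
  refine key (C.η b' - C.η a') (C.η a - C.η b) (by linarith) (by linarith) ?_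
  refine sub_eq_zero.1 (C.eq_zero_of_coords _ ?_ ?_ ?_)
  · simp only [map_sub, map_add, map_smul, oa.1, ob.1, oa'.1, ob'.1]; ring
  · simp only [map_sub, map_add, map_smul, oa.2, ob.2, oa'.2, ob'.2]; ring
  · simp only [map_sub, map_add, map_smul, smul_eq_mul]; ring

open Classical in
/-- A point of the cone `X` over the direction `d`, if there is one. -/
noncomputable def point (C : ContactSystem ι P E) (X : P) (d : ℝ × ℝ) : E :=
  if h : C.Alive X d then h.exists_over.choose else 0

/-- The height of the chosen point of the cone `X` over the direction `d`. -/
noncomputable def height (C : ContactSystem ι P E) (X : P) (d : ℝ × ℝ) : ℝ := C.η (C.point X d)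

lemma Alive.point_mem {X : P} {d : ℝ × ℝ} (h : C.Alive X d) : C.point X d ∈ C.K X := by
  rw [point, dif_pos h]; exact h.exists_over.choose_spec.1

lemma Alive.point_over {X : P} {d : ℝ × ℝ} (h : C.Alive X d) : C.Over (C.point X d) d := by
  rw [point, dif_pos h]; exact h.exists_over.choose_spec.2

/-- Heights depend on a choice of points, but comparisons do not: the preceding order lemma holds
for any points over `d` and `d'`. -/
lemma height_lt_height {X Y : P} (hXY : X ≠ Y) {d d' : ℝ × ℝ} (hd : C.Apart X Y d)
    (hd' : C.Apart X Y d') (hX : C.Alive X d) (hY : C.Alive Y d) (hX' : C.Alive X d')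
    (hY' : C.Alive Y d') (h : C.height Y d ≤ C.height X d) : C.height Y d' < C.height X d' :=
  height_lt_of_height_le hXY hd hd' hX.point_mem hX'.point_mem hY.point_mem hY'.point_mem
    hX.point_over hY.point_over hX'.point_over hY'.point_over h

lemma over_dir (u : ι) : C.Over (C.vec u) (C.dir u) := ⟨rfl, rfl⟩

/-- `d` is separated from the direction of `u` by no contact direction. -/
def Near (C : ContactSystem ι P E) (u : ι) (d : ℝ × ℝ) : Prop :=
  ∀ v, v ≠ u → C.vec v ≠ -C.vec u →
    0 < planeCross (C.dir v) d * planeCross (C.dir v) (C.dir u)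

lemma dir_opp {u v : ι} (h : C.vec v = -C.vec u) : C.dir v = -C.dir u := by
  simp [dir, h]

lemma Near.pos_iff {u v : ι} {d : ℝ × ℝ} (h : C.Near u d) (hv : v ≠ u)
    (hv' : C.vec v ≠ -C.vec u) :
    0 < planeCross (C.dir v) d ↔ 0 < planeCross (C.dir v) (C.dir u) := by
  have := h v hv hv'
  exact ⟨fun h1 => (pos_iff_pos_of_mul_pos this).1 h1, fun h1 => (pos_iff_pos_of_mul_pos this).2 h1⟩

lemma Near.neg_iff {u v : ι} {d : ℝ × ℝ} (h : C.Near u d) (hv : v ≠ u)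
    (hv' : C.vec v ≠ -C.vec u) :
    0 < planeCross d (C.dir v) ↔ 0 < planeCross (C.dir u) (C.dir v) := by
  have := h v hv hv'
  rw [planeCross_swap d, planeCross_swap (C.dir u), neg_pos, neg_pos]
  exact neg_iff_neg_of_mul_pos this

lemma Near.regular {u : ι} {d : ℝ × ℝ} (h : C.Near u d) (hu : planeCross (C.dir u) d ≠ 0) :
    C.Regular d := by
  refine ⟨?_, fun v => ?_⟩
  · rintro rfl; simp [planeCross] at hu
  · by_cases hv : v = u
    · rwa [hv]
    by_cases hv' : C.vec v = -C.vec u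
    · rw [dir_opp hv', planeCross_neg_left]; exact neg_ne_zero.2 hu
    · exact left_ne_zero_of_mul (h v hv hv').ne'

/-- Only the directions of `u` and of its opposite can change sides near `u`. The first is no vertex
of `X`, and the opposite cannot bound a sector of less than a half turn that contains a direction
near `u`. -/
lemma Near.alive_iff {u : ι} {d : ℝ × ℝ} (h : C.Near u d) {X : P} (hX : ¬ C.Mem X u) :
    C.Alive X d ↔ C.Alive X (C.dir u) := by
  constructor
  · rintro ⟨v, v', hv, hv', h1, h2, h3⟩
    have hvu : v ≠ u := by rintro rfl; exact hX hv
    have hvu' : v' ≠ u := by rintro rfl; exact hX hv'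
    have n' : C.vec v' ≠ -C.vec u := by
      intro e
      by_cases n : C.vec v = -C.vec u
      · rw [dir_opp e, dir_opp n, planeCross_self] at h3; exact h3.false
      · have := (h.pos_iff hvu n).1 h1
        rw [dir_opp e, planeCross_neg_right] at h3
        linarith
    have n : C.vec v ≠ -C.vec u := by
      intro e
      have := (h.neg_iff hvu' n').1 h2
      rw [dir_opp e, planeCross_neg_left] at h3
      linarith
    exact ⟨v, v', hv, hv', (h.pos_iff hvu n).1 h1, (h.neg_iff hvu' n').1 h2, h3⟩
  · rintro ⟨v, v', hv, hv', h1, h2, h3⟩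
    have hvu : v ≠ u := by rintro rfl; exact hX hv
    have hvu' : v' ≠ u := by rintro rfl; exact hX hv'
    have n : C.vec v ≠ -C.vec u := by
      intro e; rw [dir_opp e, planeCross_neg_left, planeCross_self] at h1; linarith
    have n' : C.vec v' ≠ -C.vec u := by
      intro e; rw [dir_opp e, planeCross_neg_right, planeCross_self] at h2; linarith
    exact ⟨v, v', hv, hv', (h.pos_iff hvu n).2 h1, (h.neg_iff hvu' n').2 h2, h3⟩

/-- A vertex of `X` preceding `u` would bound, together with `u`, a sector containing `d`. -/
lemma Near.isStart {u : ι} {d : ℝ × ℝ} (h : C.Near u d) (hu : planeCross (C.dir u) d < 0) {X : P}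
    (hX : C.Mem X u) (hd : ¬ C.Alive X d) : C.IsStart X u := by
  refine ⟨hX, fun v hv hvu => ?_⟩
  by_contra hn
  have n := hX.not_opp hv
  have h0 : 0 < planeCross (C.dir v) (C.dir u) := by
    rw [planeCross_swap]
    exact neg_pos.2 (lt_of_le_of_ne (not_lt.1 hn) (planeCross_dir_ne hvu.symm n))
  exact hd ⟨v, u, hv, hX, (h.pos_iff hvu n).2 h0, by rw [planeCross_swap]; linarith, h0⟩

lemma Near.isEnd {u : ι} {d : ℝ × ℝ} (h : C.Near u d) (hu : 0 < planeCross (C.dir u) d) {X : P}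
    (hX : C.Mem X u) (hd : ¬ C.Alive X d) : C.IsEnd X u := by
  refine ⟨hX, fun v hv hvu => ?_⟩
  by_contra hn
  have n := hX.not_opp hv
  have h0 : 0 < planeCross (C.dir u) (C.dir v) :=
    lt_of_le_of_ne (not_lt.1 hn) (planeCross_dir_ne hvu.symm n).symm
  exact hd ⟨u, v, hX, hv, hu, (h.neg_iff hvu n).2 h0, h0⟩

end ContactSystem

/-! ### Sums over consecutive pairs of a list. -/

/-- The sum of the weights of the consecutive pairs of a list. -/
def chainSum {Q : Type*} (w : Q → Q → ℤ) : List Q → ℤ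
  | [] => 0
  | [_] => 0
  | a :: b :: l => w a b + chainSum w (b :: l)

section ChainSum

variable {Q : Type*}

lemma chainSum_append (w : Q → Q → ℤ) (l : List Q) (a : Q) (m : List Q) :
    chainSum w (l ++ a :: m) = chainSum w (l ++ [a]) + chainSum w (a :: m) := by
  induction l with
  | nil => simp [chainSum]
  | cons b l ih =>
    cases l with
    | nil => simp [chainSum]
    | cons c l =>
      simp only [List.cons_append, chainSum] at ih ⊢
      rw [ih]; ring

lemma chainSum_congr {w w' : Q → Q → ℤ} {l : List Q} (h : ∀ a ∈ l, ∀ b ∈ l, w a b = w' a b) :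
    chainSum w l = chainSum w' l := by
  induction l with
  | nil => rfl
  | cons a l ih =>
    cases l with
    | nil => rfl
    | cons b l =>
      simp only [chainSum]
      rw [h a (by simp) b (by simp),
        ih fun x hx y hy => h x (List.mem_cons_of_mem _ hx) y (List.mem_cons_of_mem _ hy)]

/-- The effect on the potential of replacing, between `x` and `y`, the part of `R` and `B` that
is present before their contact by the part that is present afterwards. -/
lemma chainSum_local {w w' : Q → Q → ℤ} {x y R B : Q} (hle : ∀ a b, |w a b| ≤ 1)
    (hle' : ∀ a b, |w' a b| ≤ 1) (hR : w R B = 1) (hB : w B R = 1) (hR' : w' R B = -1)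
    (hB' : w' B R = -1) (hxR : w x R = w' x R) (hxB : w x B = w' x B) (hyR : w R y = w' R y)
    (hyB : w B y = w' B y) (hx : w' x R = 0 ∨ w' x B = 0) (hy : w' R y = 0 ∨ w' B y = 0)
    {m m' : List Q} (hm : m = [] ∨ m = [R] ∨ m = [B] ∨ m = [R, B] ∨ m = [B, R])
    (hm' : m' = [] ∨ m' = [R] ∨ m' = [B] ∨ m' = [R, B] ∨ m' = [B, R])
    (h1 : m = [R, B] → m' ≠ [B, R]) (h2 : m = [B, R] → m' ≠ [R, B])
    (h0 : m = [] → m' = [] → w x y = w' x y) :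
    chainSum w' (x :: (m' ++ [y])) - chainSum w (x :: (m ++ [y])) ≤
      2 * (4 - m.length - m'.length) - 2 := by
  have e1 := abs_le.1 (hle x y)
  have e2 := abs_le.1 (hle' x y)
  have e3 := abs_le.1 (hle' x R)
  have e4 := abs_le.1 (hle' x B)
  have e5 := abs_le.1 (hle' R y)
  have e6 := abs_le.1 (hle' B y)
  -- Two of the 25 cases reverse the order and are excluded. In a case such as `[R]` to `[B]`, `hx`
  -- and `hy` limit the gain at each end to `1` instead of `2`.
  rcases hm with rfl | rfl | rfl | rfl | rfl <;> rcases hm' with rfl | rfl | rfl | rfl | rfl <;>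
    first
    | exact absurd rfl (h1 rfl)
    | exact absurd rfl (h2 rfl)
    | (simp only [chainSum, List.nil_append, List.cons_append, List.length_cons,
        List.length_nil, hxR, hxB, hyR, hyB, hR, hB, hR', hB', Nat.cast_zero, Nat.cast_one,
        Nat.cast_add, zero_add]
       rcases hx with hx | hx <;> rcases hy with hy | hy <;> omega)

/-- A list sorted by a function that is injective on it is determined by its elements. -/
lemma List.eq_of_pairwise_gt {h : Q → ℝ} {l l' : List Q} (hl : l.Pairwise fun a b => h b < h a)
    (hl' : l'.Pairwise fun a b => h b < h a) (hm : ∀ a, a ∈ l ↔ a ∈ l') : l = l' := by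
  refine List.Perm.eq_of_pairwise (le := fun a b => h b < h a)
    (fun a b _ _ h1 h2 => absurd h1 h2.asymm) hl hl' ?_
  exact (List.perm_ext_iff_of_nodup (hl.imp fun h e => h.ne (by rw [e]))
    (hl'.imp fun h e => h.ne (by rw [e]))).2 hm

/-- A finite set on which a function is injective can be listed in decreasing order. -/
lemma Finset.exists_list_pairwise_gt (s : Finset Q) (h : Q → ℝ) (hs : Set.InjOn h s) :
    ∃ l : List Q, (l.Pairwise fun a b => h b < h a) ∧ ∀ a, a ∈ l ↔ a ∈ s := by
  classical
  have hp := List.pairwise_mergeSort (le := fun a b : Q => decide (h b ≤ h a))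
    (by intro a b c; simp only [decide_eq_true_eq]; intro h1 h2; exact h2.trans h1)
    (by intro a b; simpa using le_total _ _) s.toList
  have hperm := List.mergeSort_perm s.toList (fun a b : Q => decide (h b ≤ h a))
  refine ⟨_, ?_, fun a => hperm.mem_iff.trans Finset.mem_toList⟩
  have hn : (s.toList.mergeSort (fun a b : Q => decide (h b ≤ h a))).Nodup :=
    hperm.nodup_iff.2 s.nodup_toList
  refine (hp.and hn).imp_of_mem ?_
  intro a b ha hb hab
  have ha' := Finset.mem_toList.1 (hperm.mem_iff.1 ha)
  have hb' := Finset.mem_toList.1 (hperm.mem_iff.1 hb)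
  exact lt_of_le_of_ne (by simpa using hab.1) fun e => hab.2 (hs ha' hb' e.symm)

end ChainSum

/-! ### Weights of pairs of cones and the potential of the sweep. -/

namespace ContactSystem

variable {ι P E : Type*} [AddCommGroup E] [Module ℝ E]
  {C : ContactSystem ι P E}

open Classical in
/-- The weight of a pair of cones: `1` if their contact is ahead of the sweep, `-1` if it has been
passed, and `0` if there is none. -/
noncomputable def weight (C : ContactSystem ι P E) (d : ℝ × ℝ) (X Y : P) : ℤ :=
  if ∃ u, C.Contact X Y u ∧ 0 < planeCross (C.dir u) d then -1
  else if ∃ u, C.Contact X Y u ∧ planeCross (C.dir u) d < 0 then 1 else 0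

/-- The weight, extended by zero to dummy cones above and below all others. -/
noncomputable def weight' (C : ContactSystem ι P E) (d : ℝ × ℝ) : Option P → Option P → ℤ
  | some X, some Y => C.weight d X Y
  | _, _ => 0

lemma abs_weight_le (d : ℝ × ℝ) (X Y : P) : |C.weight d X Y| ≤ 1 := by
  unfold weight; split_ifs <;> simp

lemma abs_weight'_le (d : ℝ × ℝ) (x y : Option P) : |C.weight' d x y| ≤ 1 := by
  rcases x with _ | X <;> rcases y with _ | Y <;> simp only [weight', abs_zero, zero_le_one]
  exact abs_weight_le d X Y

lemma weight_comm (d : ℝ × ℝ) (X Y : P) : C.weight d X Y = C.weight d Y X := by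
  have h : ∀ u, C.Contact X Y u ↔ C.Contact Y X u := fun u => ⟨Contact.symm, Contact.symm⟩
  classical
  unfold weight
  exact if_congr (exists_congr fun u => and_congr_left' (h u)) rfl
    (if_congr (exists_congr fun u => and_congr_left' (h u)) rfl rfl)

lemma weight_congr {d d' : ℝ × ℝ} {X Y : P} (h : ∀ u, C.Contact X Y u →
    0 < planeCross (C.dir u) d * planeCross (C.dir u) d') : C.weight d X Y = C.weight d' X Y := by
  have h1 : ∀ u, (C.Contact X Y u ∧ 0 < planeCross (C.dir u) d) ↔
      (C.Contact X Y u ∧ 0 < planeCross (C.dir u) d') := fun u =>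
    and_congr_right fun hu => pos_iff_pos_of_mul_pos (h u hu)
  have h2 : ∀ u, (C.Contact X Y u ∧ planeCross (C.dir u) d < 0) ↔
      (C.Contact X Y u ∧ planeCross (C.dir u) d' < 0) := fun u =>
    and_congr_right fun hu => neg_iff_neg_of_mul_pos (h u hu)
  classical
  unfold weight
  exact if_congr (exists_congr h1) rfl (if_congr (exists_congr h2) rfl rfl)

lemma Contact.weight_of_pos {X Y : P} {u : ι} (h : C.Contact X Y u) {d : ℝ × ℝ}
    (hu : 0 < planeCross (C.dir u) d) : C.weight d X Y = -1 := by
  rw [weight, if_pos ⟨u, h, hu⟩]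

lemma Contact.weight_of_neg {X Y : P} {u : ι} (h : C.Contact X Y u) {d : ℝ × ℝ}
    (hu : planeCross (C.dir u) d < 0) : C.weight d X Y = 1 := by
  rw [weight, if_neg, if_pos ⟨u, h, hu⟩]
  rintro ⟨v, hv, hv'⟩
  rw [hv.unique h] at hv'
  exact hv'.asymm hu

lemma weight_eq_zero {d : ℝ × ℝ} {X Y : P} (h : ∀ u, ¬ C.Contact X Y u) : C.weight d X Y = 0 := by
  rw [weight, if_neg, if_neg] <;> exact fun ⟨u, hu, _⟩ => h u hu

/-- Contacts join opposite colours only, so `X` cannot touch both a red and a blue cone. -/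
lemma weight_red_or_blue (d : ℝ × ℝ) (X : P) (u : ι) :
    C.weight d X (C.red u) = 0 ∨ C.weight d X (C.blue u) = 0 := by
  by_cases h : ∃ v, C.Contact X (C.red u) v
  · right
    obtain ⟨v, hv⟩ := h
    refine weight_eq_zero fun v' hv' => ?_
    rcases hv with hv | hv
    · exact C.red_ne_blue u v hv.2.symm
    · rcases hv' with hv' | hv'
      · exact C.red_ne_blue v' v (hv'.1.trans hv.2.symm)
      · exact C.red_ne_blue v' u hv'.1
  · left
    exact weight_eq_zero fun v hv => h ⟨v, hv⟩

lemma weight_red_or_blue' (d : ℝ × ℝ) (X : P) (u : ι) :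
    C.weight d (C.red u) X = 0 ∨ C.weight d (C.blue u) X = 0 := by
  rw [weight_comm d _ X, weight_comm d _ X]; exact weight_red_or_blue d X u

variable [Fintype P]

lemma exists_order (C : ContactSystem ι P E) (d : ℝ × ℝ) (hd : C.Regular d) :
    ∃ l : List P, (l.Pairwise fun X Y => C.height Y d < C.height X d) ∧
      ∀ X, X ∈ l ↔ C.Alive X d := by
  classical
  obtain ⟨l, hl, hm⟩ := (Finset.univ.filter (C.Alive · d)).exists_list_pairwise_gt (C.height · d) (by
    intro X hX Y hY e
    by_contra hne
    simp only [Finset.coe_filter, Finset.mem_univ, true_and, Set.mem_ofPred_eq] at hX hY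
    exact (height_lt_height hne (hd.apart _ _) (hd.apart _ _) hX hY hX hY e.ge).ne e.symm)
  exact ⟨l, hl, fun X => by simp [hm]⟩

open Classical in
/-- The cones that are met over the direction `d`, from top to bottom. -/
noncomputable def order (C : ContactSystem ι P E) (d : ℝ × ℝ) : List P :=
  if h : C.Regular d then (C.exists_order d h).choose else []

lemma Regular.order_eq {d : ℝ × ℝ} (hd : C.Regular d) {l : List P}
    (hl : l.Pairwise fun X Y => C.height Y d < C.height X d) (hm : ∀ X, X ∈ l ↔ C.Alive X d) :
    C.order d = l := by
  rw [order, dif_pos hd]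
  have := (C.exists_order d hd).choose_spec
  exact List.eq_of_pairwise_gt this.1 hl fun X => (this.2 X).trans (hm X).symm

lemma Regular.mem_order {d : ℝ × ℝ} (hd : C.Regular d) {X : P} : X ∈ C.order d ↔ C.Alive X d := by
  rw [order, dif_pos hd]
  exact (C.exists_order d hd).choose_spec.2 X

lemma Regular.pairwise_order {d : ℝ × ℝ} (hd : C.Regular d) :
    (C.order d).Pairwise fun X Y => C.height Y d < C.height X d := by
  rw [order, dif_pos hd]
  exact (C.exists_order d hd).choose_spec.1

/-- The potential of the sweep. -/
noncomputable def potential (C : ContactSystem ι P E) (d : ℝ × ℝ) : ℤ :=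
  chainSum (C.weight' d) (none :: ((C.order d).map some ++ [none]))

lemma potential_congr {d d' : ℝ × ℝ} (hd : d ≠ 0) (hd' : d' ≠ 0)
    (h : ∀ u, 0 < planeCross (C.dir u) d * planeCross (C.dir u) d') :
    C.potential d = C.potential d' := by
  have r : C.Regular d := ⟨hd, fun u => left_ne_zero_of_mul (h u).ne'⟩
  have r' : C.Regular d' := ⟨hd', fun u => right_ne_zero_of_mul (h u).ne'⟩
  have ha : ∀ X, C.Alive X d ↔ C.Alive X d' := by
    intro X
    have h1 := fun u => pos_iff_pos_of_mul_pos (h u)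
    have h2 : ∀ u, 0 < planeCross d (C.dir u) ↔ 0 < planeCross d' (C.dir u) := fun u => by
      rw [planeCross_swap d, planeCross_swap d', neg_pos, neg_pos]
      exact neg_iff_neg_of_mul_pos (h u)
    simp only [Alive, h1, h2]
  have ho : C.order d = C.order d' := by
    refine r.order_eq ?_ fun X => r'.mem_order.trans (ha X).symm
    refine r'.pairwise_order.imp_of_mem ?_
    intro X Y hX hY hXY
    rw [r'.mem_order] at hX hY
    exact height_lt_height (by rintro rfl; exact hXY.false) (r'.apart _ _) (r.apart _ _) hX hY
      ((ha X).2 hX) ((ha Y).2 hY) hXY.le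
  have hw : C.weight' d = C.weight' d' := by
    funext X Y
    rcases X with _ | X <;> rcases Y with _ | Y <;> try rfl
    exact weight_congr fun u _ => h u
  rw [potential, potential, ho, hw]

end ContactSystem

/-! ### The change of the potential at one contact. -/

section Lists

variable {Q : Type*}

lemma List.eq_of_nodup_of_mem_pair {l : List Q} {R B : Q} (hl : l.Nodup)
    (h : ∀ x ∈ l, x = R ∨ x = B) :
    l = [] ∨ l = [R] ∨ l = [B] ∨ l = [R, B] ∨ l = [B, R] := by
  rcases l with _ | ⟨a, _ | ⟨b, _ | ⟨c, l⟩⟩⟩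
  · simp
  · have := h a (by simp); grind
  · have := h a (by simp); have := h b (by simp); grind
  · exfalso
    have := h a (by simp); have := h b (by simp); have := h c (by simp); grind

open Classical in
lemma List.length_of_nodup_of_mem_pair {l : List Q} {R B : Q} (hl : l.Nodup) (hRB : R ≠ B)
    (h : ∀ x ∈ l, x = R ∨ x = B) :
    (l.length : ℤ) = (if R ∈ l then 1 else 0) + (if B ∈ l then 1 else 0) := by
  rcases List.eq_of_nodup_of_mem_pair hl h with rfl | rfl | rfl | rfl | rfl <;>
    simp [hRB, hRB.symm]

end Lists

namespace ContactSystem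

variable {ι P E : Type*} [AddCommGroup E] [Module ℝ E] {C : ContactSystem ι P E}

lemma Near.height_lt_of_lt {u : ι} {d : ℝ × ℝ} (h : C.Near u d)
    (hu : planeCross (C.dir u) d ≠ 0) {X Y : P} (hX : ¬ C.Mem X u) (hY : C.Mem Y u)
    (aX : C.Alive X d) (aY : C.Alive Y d) (hlt : C.η (C.vec u) < C.height X (C.dir u)) :
    C.height Y d < C.height X d := by
  have hXY : X ≠ Y := by rintro rfl; exact hX hY
  have aX' := (h.alive_iff hX).1 aX
  exact height_lt_of_height_le hXY (apart_dir fun hc => hX hc.mem_left)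
    ((h.regular hu).apart X Y) aX'.point_mem aX.point_mem hY.vec_mem aY.point_mem
    aX'.point_over (over_dir u) aX.point_over aY.point_over hlt.le

lemma Near.height_lt_of_ge {u : ι} {d : ℝ × ℝ} (h : C.Near u d)
    (hu : planeCross (C.dir u) d ≠ 0) {X Y : P} (hX : ¬ C.Mem X u) (hY : C.Mem Y u)
    (aX : C.Alive X d) (aY : C.Alive Y d) (hle : C.height X (C.dir u) ≤ C.η (C.vec u)) :
    C.height X d < C.height Y d := by
  have hXY : Y ≠ X := by rintro rfl; exact hX hY
  have aX' := (h.alive_iff hX).1 aX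
  exact height_lt_of_height_le hXY (apart_dir fun hc => hX hc.mem_right)
    ((h.regular hu).apart Y X) hY.vec_mem aY.point_mem aX'.point_mem aX.point_mem
    (over_dir u) aX'.point_over aY.point_over aX.point_over hle

lemma Near.height_lt_iff {u : ι} {d : ℝ × ℝ} (h : C.Near u d)
    (hu : planeCross (C.dir u) d ≠ 0) {X Y : P} (hXY : X ≠ Y) (hX : ¬ C.Mem X u)
    (hY : ¬ C.Mem Y u) (aX : C.Alive X (C.dir u)) (aY : C.Alive Y (C.dir u))
    (hlt : C.height Y (C.dir u) < C.height X (C.dir u)) : C.height Y d < C.height X d :=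
  height_lt_height hXY (apart_dir fun hc => hX hc.mem_left) ((h.regular hu).apart X Y) aX aY
    ((h.alive_iff hX).2 aX) ((h.alive_iff hY).2 aY) hlt.le

/-- Adding to a point over the direction of `u` the opposite contact vector gives a nonzero vector
on the axis. Hence the weight that flips at the antipode of `u` belongs to cones that are not both
met. -/
lemma no_polar' {u v : ι} (h : C.vec v = -C.vec u) {X Y : P} (hc : C.Contact X Y v)
    (aX : C.Alive X (C.dir u)) (aY : C.Alive Y (C.dir u)) : False := by
  have key : ∀ Z, C.Mem Z v → C.Alive Z (C.dir u) → ∃ a ∈ C.K Z, a ≠ 0 ∧ C.α a = 0 ∧ C.β a = 0 := by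
    intro Z hZ aZ
    refine ⟨_, add_mem aZ.point_mem hZ.vec_mem, fun e => ?_, ?_, ?_⟩
    · exact aZ.point_over.ne_zero (C.dir_ne_zero u)
        (C.salient Z _ aZ.point_mem _ hZ.vec_mem e)
    · rw [map_add, aZ.point_over.1, h, map_neg]; exact add_neg_cancel _
    · rw [map_add, aZ.point_over.2, h, map_neg]; exact add_neg_cancel _
  obtain ⟨a, ha, a0, a1, a2⟩ := key X hc.mem_left aX
  obtain ⟨b, hb, b0, b1, b2⟩ := key Y hc.mem_right aY
  rcases hc with ⟨rfl, rfl⟩ | ⟨rfl, rfl⟩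
  · exact C.no_polar v a ha b hb a0 b0 a1 a2 b1 b2
  · exact C.no_polar v b hb a ha b0 a0 b1 b2 a1 a2

section Event

variable {u : ι} {d d' : ℝ × ℝ}

/-- The weight could change only through a contact at `u`, excluded by `hX`, or at its opposite,
excluded by salience or by `no_polar'`. -/
lemma Near.weight_eq (h : C.Near u d) (h' : C.Near u d') {X Y : P} (hX : ¬ C.Mem X u)
    (hY : C.Mem Y u ∨ C.Alive X (C.dir u) ∧ C.Alive Y (C.dir u)) :
    C.weight d X Y = C.weight d' X Y := by
  refine weight_congr fun v hv => ?_
  have hvu : v ≠ u := by rintro rfl; exact hX hv.mem_left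
  have hn : C.vec v ≠ -C.vec u := by
    intro e
    rcases hY with hY | ⟨aX, aY⟩
    · exact hY.not_opp hv.mem_right e
    · exact no_polar' e hv aX aY
  have h1 := h v hvu hn
  have h2 := h' v hvu hn
  rcases lt_or_gt_of_ne (right_ne_zero_of_mul h1.ne') with h0 | h0
  · exact mul_pos_of_neg_of_neg (neg_of_mul_pos_left h1 h0.le) (neg_of_mul_pos_left h2 h0.le)
  · exact mul_pos (pos_of_mul_pos_left h1 h0.le) (pos_of_mul_pos_left h2 h0.le)

variable [Fintype P]

open Classical in
/-- The cones present over `d` that pass above the ray `u`. -/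
noncomputable def above (C : ContactSystem ι P E) (u : ι) (d : ℝ × ℝ) : List P :=
  (C.order d).filter fun X => ¬ C.Mem X u ∧ C.η (C.vec u) < C.height X (C.dir u)

open Classical in
/-- The cones present over `d` that pass below the ray `u`. -/
noncomputable def below (C : ContactSystem ι P E) (u : ι) (d : ℝ × ℝ) : List P :=
  (C.order d).filter fun X => ¬ C.Mem X u ∧ ¬ C.η (C.vec u) < C.height X (C.dir u)

open Classical in
/-- The cones present over `d` that have `u` as a vertex. -/
noncomputable def through (C : ContactSystem ι P E) (u : ι) (d : ℝ × ℝ) : List P :=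
  (C.order d).filter fun X => C.Mem X u

/-- A cone avoiding `u` stays on its side of the ray, so the cones through `u` form one contiguous
block. -/
lemma Near.order_eq_append (h : C.Near u d) (hu : planeCross (C.dir u) d ≠ 0) :
    C.order d = C.above u d ++ (C.through u d ++ C.below u d) := by
  have r := h.regular hu
  refine r.order_eq ?_ ?_
  · rw [List.pairwise_append, List.pairwise_append]
    refine ⟨r.pairwise_order.filter _, ⟨r.pairwise_order.filter _, r.pairwise_order.filter _, ?_⟩, ?_⟩
    · intro Y hY X hX
      simp only [through, below, List.mem_filter, decide_eq_true_eq, r.mem_order] at hX hY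
      exact h.height_lt_of_ge hu hX.2.1 hY.2 hX.1 hY.1 (not_lt.1 hX.2.2)
    · intro X hX Y hY
      simp only [above, through, below, List.mem_append, List.mem_filter, decide_eq_true_eq,
        r.mem_order] at hX hY
      rcases hY with hY | hY
      · exact h.height_lt_of_lt hu hX.2.1 hY.2 hX.1 hY.1 hX.2.2
      · exact h.height_lt_iff hu (by rintro rfl; exact hY.2.2 hX.2.2) hX.2.1 hY.2.1
          ((h.alive_iff hX.2.1).1 hX.1) ((h.alive_iff hY.2.1).1 hY.1)
          ((not_lt.1 hY.2.2).trans_lt hX.2.2)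
  · intro X
    simp only [above, through, below, List.mem_append, List.mem_filter, decide_eq_true_eq,
      r.mem_order]
    tauto

lemma Near.filter_order_eq (h : C.Near u d) (hu : planeCross (C.dir u) d ≠ 0)
    (h' : C.Near u d') (hu' : planeCross (C.dir u) d' ≠ 0) {p : P → Bool}
    (hp : ∀ X, p X = true → ¬ C.Mem X u) : (C.order d).filter p = (C.order d').filter p := by
  have r := h.regular hu
  have r' := h'.regular hu'
  refine List.eq_of_pairwise_gt (h := (C.height · d)) (r.pairwise_order.filter _)
    ((r'.pairwise_order.filter _).imp_of_mem ?_) fun X => ?_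
  · intro X Y hX hY hXY
    simp only [List.mem_filter, r'.mem_order] at hX hY
    exact height_lt_height (by rintro rfl; exact hXY.false) (r'.apart X Y) (r.apart X Y) hX.1 hY.1
      ((h.alive_iff (hp X hX.2)).2 ((h'.alive_iff (hp X hX.2)).1 hX.1))
      ((h.alive_iff (hp Y hY.2)).2 ((h'.alive_iff (hp Y hY.2)).1 hY.1)) hXY.le
  · simp only [List.mem_filter, r.mem_order, r'.mem_order]
    exact and_congr_left fun hX => (h.alive_iff (hp X hX)).trans (h'.alive_iff (hp X hX)).symm

lemma Near.through_spec (h : C.Near u d) (hu : planeCross (C.dir u) d ≠ 0) :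
    (C.through u d).Nodup ∧ ∀ X ∈ C.through u d, X = C.red u ∨ X = C.blue u := by
  refine ⟨((h.regular hu).pairwise_order.filter _).imp fun h e => h.ne (by rw [e]), ?_⟩
  intro X hX
  simp only [through, List.mem_filter, decide_eq_true_eq] at hX
  rcases hX.2 with e | e
  · exact Or.inl e.symm
  · exact Or.inr e.symm

open Classical in
lemma Near.length_through (h : C.Near u d) (hu : planeCross (C.dir u) d ≠ 0) :
    ((C.through u d).length : ℤ) =
      (if C.Alive (C.red u) d then 1 else 0) + (if C.Alive (C.blue u) d then 1 else 0) := by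
  have r := h.regular hu
  rw [List.length_of_nodup_of_mem_pair (h.through_spec hu).1 (C.red_ne_blue u u)
    (h.through_spec hu).2]
  have h1 : C.Mem (C.red u) u := Or.inl rfl
  have h2 : C.Mem (C.blue u) u := Or.inr rfl
  simp only [through, List.mem_filter, decide_eq_true_eq, h1, h2, and_true, r.mem_order]

open Classical in
/-- The number of cones starting or ending at the ray `u`. -/
noncomputable def marks (C : ContactSystem ι P E) (u : ι) : ℤ :=
  ((if C.IsStart (C.red u) u then 1 else 0) + (if C.IsStart (C.blue u) u then 1 else 0)) +
  ((if C.IsEnd (C.red u) u then 1 else 0) + (if C.IsEnd (C.blue u) u then 1 else 0))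

lemma marks_ge (h : C.Near u d) (hu : planeCross (C.dir u) d < 0) (h' : C.Near u d')
    (hu' : 0 < planeCross (C.dir u) d') :
    4 - ((C.through u d).length : ℤ) - (C.through u d').length ≤ C.marks u := by
  classical
  rw [h.length_through hu.ne, h'.length_through hu'.ne', marks]
  have h1 : C.Mem (C.red u) u := Or.inl rfl
  have h2 : C.Mem (C.blue u) u := Or.inr rfl
  have s1 := h.isStart hu h1
  have s2 := h.isStart hu h2
  have e1 := h'.isEnd hu' h1
  have e2 := h'.isEnd hu' h2
  have c1 : ∀ {p q : Prop} [Decidable p] [Decidable q], (¬ p → q) →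
      (1 : ℤ) - (if p then 1 else 0) ≤ if q then 1 else 0 := by
    intro p q _ _ hpq
    by_cases hp : p
    · rw [if_pos hp]; split_ifs <;> norm_num
    · rw [if_neg hp, if_pos (hpq hp)]; norm_num
  have := c1 s1; have := c1 s2; have := c1 e1; have := c1 e2
  linarith

lemma potential_sub_le (h : C.Near u d) (hu : planeCross (C.dir u) d < 0) (h' : C.Near u d')
    (hu' : 0 < planeCross (C.dir u) d') :
    C.potential d' - C.potential d ≤ 2 * C.marks u - 2 := by
  classical
  have r := h.regular hu.ne
  have r' := h'.regular hu'.ne'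
  have h1 : C.Mem (C.red u) u := Or.inl rfl
  have h2 : C.Mem (C.blue u) u := Or.inr rfl
  have hRB : C.Contact (C.red u) (C.blue u) u := Or.inl ⟨rfl, rfl⟩
  have ea : C.above u d' = C.above u d :=
    (h'.filter_order_eq hu'.ne' h hu.ne fun X hX => (of_decide_eq_true hX).1)
  have eb : C.below u d' = C.below u d :=
    (h'.filter_order_eq hu'.ne' h hu.ne fun X hX => (of_decide_eq_true hX).1)
  have good : ∀ X, X ∈ C.above u d ∨ X ∈ C.below u d → ¬ C.Mem X u ∧ C.Alive X (C.dir u) := by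
    intro X hX
    simp only [above, below, List.mem_filter, decide_eq_true_eq, r.mem_order] at hX
    have hX' : ¬ C.Mem X u := hX.elim (·.2.1) (·.2.1)
    exact ⟨hX', (h.alive_iff hX').1 (hX.elim (·.1) (·.1))⟩
  -- The dummies ensure that the block through `u` always has a neighbour `x` above and `y` below.
  obtain ⟨A, x, hA⟩ : ∃ A x, (none :: (C.above u d).map some : List (Option P)) = A ++ [x] :=
    ⟨_, _, (List.dropLast_append_getLast (List.cons_ne_nil _ _)).symm⟩
  obtain ⟨y, B, hB⟩ : ∃ y B, ((C.below u d).map some ++ [none] : List (Option P)) = y :: B :=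
    List.exists_cons_of_ne_nil (by simp)
  let G : Option P → Prop := fun z => ∀ X, z = some X → ¬ C.Mem X u ∧ C.Alive X (C.dir u)
  have gA : ∀ z ∈ A ++ [x], G z := by
    rintro z hz X rfl
    rw [← hA] at hz
    exact good X (Or.inl (by simpa using hz))
  have gB : ∀ z ∈ y :: B, G z := by
    rintro z hz X rfl
    rw [← hB] at hz
    exact good X (Or.inr (by simpa using hz))
  have hw : ∀ a b, G a → G b → C.weight' d a b = C.weight' d' a b := by
    rintro (_ | X) (_ | Y) ha hb <;> try rfl
    exact h.weight_eq h' (ha X rfl).1 (Or.inr ⟨(ha X rfl).2, (hb Y rfl).2⟩)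
  have hw1 : ∀ a Y, G a → C.Mem Y u → C.weight' d a (some Y) = C.weight' d' a (some Y) := by
    rintro (_ | X) Y ha hY
    · rfl
    exact h.weight_eq h' (ha X rfl).1 (Or.inl hY)
  have hcomm : ∀ d (a b : Option P), C.weight' d a b = C.weight' d b a := by
    rintro d (_ | X) (_ | Y) <;> try rfl
    exact weight_comm d X Y
  have pot : ∀ e, C.order e = C.above u d ++ (C.through u e ++ C.below u d) →
      C.potential e = chainSum (C.weight' e) (A ++ [x]) +
        (chainSum (C.weight' e) (x :: ((C.through u e).map some ++ [y])) +
          chainSum (C.weight' e) (y :: B)) := by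
    intro e he
    have : none :: ((C.order e).map some ++ [none]) =
        A ++ x :: ((C.through u e).map some ++ y :: B) := by
      rw [he, ← hB]
      have : A ++ x :: ((C.through u e).map some ++ ((C.below u d).map some ++ [none])) =
        (A ++ [x]) ++ ((C.through u e).map some ++ ((C.below u d).map some ++ [none])) := by simp
      rw [this, ← hA]
      simp
    rw [potential, this, chainSum_append]
    congr 1
    exact chainSum_append _ (x :: (C.through u e).map some) y B
  have gx : G x := gA x (by simp)
  have gy : G y := gB y (by simp)
  rw [pot d (h.order_eq_append hu.ne),
    pot d' (by rw [← ea, ← eb]; exact h'.order_eq_append hu'.ne'),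
    chainSum_congr (w := C.weight' d) (w' := C.weight' d') fun a ha b hb => hw a b (gA a ha) (gA b hb),
    chainSum_congr (w := C.weight' d) (w' := C.weight' d') (l := y :: B)
      fun a ha b hb => hw a b (gB a ha) (gB b hb)]
  have cases5 : ∀ e, C.Near u e → planeCross (C.dir u) e ≠ 0 →
      (C.through u e).map some = [] ∨ (C.through u e).map some = [some (C.red u)] ∨
      (C.through u e).map some = [some (C.blue u)] ∨
      (C.through u e).map some = [some (C.red u), some (C.blue u)] ∨
      (C.through u e).map some = [some (C.blue u), some (C.red u)] := by
    intro e he hue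
    rcases List.eq_of_nodup_of_mem_pair (he.through_spec hue).1 (he.through_spec hue).2 with
      t | t | t | t | t <;> rw [t] <;> simp
  -- Two cones do not exchange their order at their contact: the order is the same over all regular
  -- directions where both are met.
  have flip : ∀ X Y, (C.through u d).map some = [some X, some Y] →
      (C.through u d').map some ≠ [some Y, some X] := by
    intro X Y e e'
    have e1 : C.through u d = [X, Y] := List.map_injective_iff.2 (Option.some_injective _) e
    have e1' : C.through u d' = [Y, X] := List.map_injective_iff.2 (Option.some_injective _) e'
    have p : (C.through u d).Pairwise _ := r.pairwise_order.filter _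
    have p' : (C.through u d').Pairwise _ := r'.pairwise_order.filter _
    have m : ∀ Z ∈ C.through u d, C.Alive Z d := fun Z hZ =>
      r.mem_order.1 (List.mem_filter.1 hZ).1
    have m' : ∀ Z ∈ C.through u d', C.Alive Z d' := fun Z hZ =>
      r'.mem_order.1 (List.mem_filter.1 hZ).1
    rw [e1] at p m
    rw [e1'] at p' m'
    have q : C.height Y d < C.height X d := by simpa using p
    have q' : C.height X d' < C.height Y d' := by simpa using p'
    exact q'.asymm (height_lt_height (by rintro rfl; exact q.false) (r.apart _ _) (r'.apart _ _)
      (m X (by simp)) (m Y (by simp)) (m' X (by simp)) (m' Y (by simp)) q.le)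
  have main := chainSum_local (w := C.weight' d) (w' := C.weight' d') (x := x) (y := y)
    (R := some (C.red u)) (B := some (C.blue u)) (abs_weight'_le d) (abs_weight'_le d')
    (hRB.weight_of_neg hu) (hRB.symm.weight_of_neg hu) (hRB.weight_of_pos hu')
    (hRB.symm.weight_of_pos hu') (hw1 x _ gx h1) (hw1 x _ gx h2)
    (by rw [hcomm _ _ y, hcomm _ _ y]; exact hw1 y _ gy h1)
    (by rw [hcomm _ _ y, hcomm _ _ y]; exact hw1 y _ gy h2)
    (by
      rcases x with _ | X
      · exact Or.inl rfl
      · exact weight_red_or_blue d' X u)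
    (by
      rcases y with _ | Y
      · exact Or.inl rfl
      · exact weight_red_or_blue' d' Y u)
    (cases5 d h hu.ne) (cases5 d' h' hu'.ne') (flip _ _) (flip _ _)
    (fun _ _ => hw x y gx gy)
  have := marks_ge h hu h' hu'
  simp only [List.length_map] at main
  linarith

end Event

end ContactSystem

/-! ### Summing the jumps over a full turn. -/

open Filter Topology in
/-- A function on the line that is constant away from finitely many times and increases by at most
`g u` at the time of `u` increases in total by at most the sum of the `g u`. -/
lemma sub_le_sum_of_jumps {ι : Type*} (U : Finset ι) (time : ι → ℝ) (inj : Set.InjOn time U)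
    (f : ℝ → ℤ) (g : ι → ℤ)
    (h0 : ∀ a b, a < b → (∀ u ∈ U, time u ∉ Set.Icc a b) → f a = f b)
    (h1 : ∀ u ∈ U, ∀ a b, a < time u → time u < b →
      (∀ v ∈ U, v ≠ u → time v ∉ Set.Icc a b) → f b - f a ≤ g u)
    {a b : ℝ} (hab : a < b) (ha : ∀ u ∈ U, a < time u) (hb : ∀ u ∈ U, time u < b) :
    f b - f a ≤ ∑ u ∈ U, g u := by
  classical
  suffices H : ∀ W ⊆ U, ∀ a, a < b → (∀ u ∈ W, a < time u) → (∀ u ∈ U \ W, time u < a) →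
      f b - f a ≤ ∑ u ∈ W, g u from H U subset_rfl a hab ha (by simp)
  intro W
  induction W using Finset.strongInduction with
  | H W ih =>
    intro hW a hab ha ha'
    rcases W.eq_empty_or_nonempty with rfl | hne
    · rw [h0 a b hab, sub_self, Finset.sum_empty]
      intro u hu h
      exact (ha' u (by simpa using hu)).not_ge h.1
    obtain ⟨u, hu, hmin⟩ := W.exists_min_image time hne
    have hlt : ∀ v ∈ W.erase u, time u < time v := fun v hv =>
      lt_of_le_of_ne (hmin v (Finset.mem_of_mem_erase hv)) fun e =>
        Finset.ne_of_mem_erase hv (inj (hW (Finset.mem_of_mem_erase hv)) (hW hu) e.symm)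
    have ev : ∀ᶠ c in 𝓝[>] (time u), c < b ∧ ∀ v ∈ W.erase u, c < time v := by
      refine Filter.Eventually.and ?_ ((Filter.eventually_all_finset _).2 fun v hv => ?_)
      · exact mem_of_superset (Ioo_mem_nhdsGT (hb u (hW hu))) fun c hc => hc.2
      · exact mem_of_superset (Ioo_mem_nhdsGT (hlt v hv)) fun c hc => hc.2
    -- `c` lies after the first remaining jump and before all later ones.
    obtain ⟨c, ⟨hcb, hc⟩, huc⟩ := (ev.and self_mem_nhdsWithin).exists
    have huc : time u < c := huc
    have s1 := h1 u (hW hu) a c (ha u hu) huc (by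
      intro v hv hvu h
      by_cases hvW : v ∈ W
      · exact (hc v (Finset.mem_erase.2 ⟨hvu, hvW⟩)).not_ge h.2
      · exact (ha' v (Finset.mem_sdiff.2 ⟨hv, hvW⟩)).not_ge h.1)
    have s2 := ih (W.erase u) (Finset.erase_ssubset hu) ((Finset.erase_subset _ _).trans hW) c hcb hc
      (by
        intro v hv
        rw [Finset.mem_sdiff, Finset.mem_erase] at hv
        by_cases hvu : v = u
        · rwa [hvu]
        · exact (ha' v (Finset.mem_sdiff.2 ⟨hv.1, fun h => hv.2 ⟨hvu, h⟩⟩)).trans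
            ((ha u hu).trans huc))
    rw [← Finset.add_sum_erase _ _ hu]
    linarith

namespace ContactSystem

variable {ι P E : Type*} [AddCommGroup E] [Module ℝ E] {C : ContactSystem ι P E}

/-- The slope of the direction of a contact ray. -/
noncomputable def slope (C : ContactSystem ι P E) (u : ι) : ℝ := C.β (C.vec u) / C.α (C.vec u)

lemma β_eq (u : ι) : C.β (C.vec u) = C.α (C.vec u) * C.slope u := by
  rw [slope, mul_div_cancel₀ _ (C.α_vec_ne u)]

lemma planeCross_dir_path (u : ι) (σ τ : ℝ) :
    planeCross (C.dir u) (σ, σ * τ) = σ * C.α (C.vec u) * (τ - C.slope u) := by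
  simp only [planeCross, dir, β_eq]; ring

lemma planeCross_dir_dir (u v : ι) : planeCross (C.dir v) (C.dir u) =
    C.α (C.vec v) * C.α (C.vec u) * (C.slope u - C.slope v) := by
  simp only [planeCross, dir, β_eq]; ring

lemma exists_rep (C : ContactSystem ι P E) {σ : ℝ} (hσ : σ ≠ 0) (v : ι) :
    ∃ v', 0 < σ * C.α (C.vec v') ∧ C.slope v' = C.slope v ∧ (v' = v ∨ C.vec v = -C.vec v') := by
  rcases lt_or_gt_of_ne (mul_ne_zero hσ (C.α_vec_ne v)) with h | h
  · obtain ⟨v', hv'⟩ := C.opp v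
    refine ⟨v', ?_, ?_, Or.inr (by rw [hv', neg_neg])⟩
    · rw [hv', map_neg]; linarith
    · rw [slope, hv', map_neg, map_neg, neg_div_neg_eq, slope]
  · exact ⟨v, h, rfl, Or.inl rfl⟩

/-- As `τ` grows, `(σ, σ * τ)` sweeps a half turn counterclockwise, and the time of a contact is its
slope. Genericity makes the slopes of the contacts in this half turn distinct. -/
lemma potential_path_sub_le [Fintype ι] [Fintype P] (C : ContactSystem ι P E) {σ : ℝ} (hσ : σ ≠ 0)
    {a b : ℝ} (hab : a < b) (ha : ∀ u, a < C.slope u) (hb : ∀ u, C.slope u < b) :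
    C.potential (σ, σ * b) - C.potential (σ, σ * a) ≤
      ∑ u with 0 < σ * C.α (C.vec u), (2 * C.marks u - 2) := by
  have out : ∀ {s t a b : ℝ}, s ∈ Set.Icc a b → t ∈ Set.Icc a b → ∀ {x}, x ∉ Set.Icc a b →
      0 < (s - x) * (t - x) := by
    intro s t a b hs ht x hx
    rw [Set.mem_Icc, not_and_or, not_le, not_le] at hx
    rcases hx with hx | hx
    · exact mul_pos (by linarith [hs.1]) (by linarith [ht.1])
    · exact mul_pos_of_neg_of_neg (by linarith [hs.2]) (by linarith [ht.2])
  have ne0 : ∀ τ : ℝ, ((σ, σ * τ) : ℝ × ℝ) ≠ 0 := fun τ e => hσ (congrArg Prod.fst e)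
  refine sub_le_sum_of_jumps _ C.slope ?_ (fun τ => C.potential (σ, σ * τ)) _ ?_ ?_ hab
    (fun u _ => ha u) (fun u _ => hb u)
  · intro u hu v hv e
    simp only [Finset.coe_filter, Finset.mem_univ, true_and, Set.mem_ofPred_eq] at hu hv
    by_contra hne
    have := C.generic u v hne (by rw [β_eq, β_eq, e]; ring)
    rw [this, map_neg] at hv
    linarith
  · intro a b hab h
    refine potential_congr (ne0 _) (ne0 _) fun v => ?_
    obtain ⟨v', hv', e, _⟩ := C.exists_rep hσ v
    have h1 := out (Set.left_mem_Icc.2 hab.le) (Set.right_mem_Icc.2 hab.le)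
      (h v' (by simpa using hv'))
    rw [e] at h1
    rw [planeCross_dir_path, planeCross_dir_path]
    have h2 : 0 < (σ * C.α (C.vec v)) ^ 2 := by
      have := C.α_vec_ne v
      positivity
    calc 0 < _ := mul_pos h2 h1
      _ = _ := by ring
  · intro u hu a b hau hub h
    replace hu : 0 < σ * C.α (C.vec u) := by simpa using hu
    have near : ∀ τ ∈ Set.Icc a b, C.Near u (σ, σ * τ) := by
      intro τ hτ v hvu hn
      obtain ⟨v', hv', e, hor⟩ := C.exists_rep hσ v
      have hne : v' ≠ u := by
        rintro rfl
        rcases hor with hor | hor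
        · exact hvu hor.symm
        · exact hn hor
      have h1 := out hτ ⟨hau.le, hub.le⟩ (h v' (by simpa using hv') hne)
      rw [e] at h1
      rw [planeCross_dir_path, planeCross_dir_dir]
      have h2 : 0 < C.α (C.vec v) ^ 2 := by
        have := C.α_vec_ne v
        positivity
      calc 0 < _ := mul_pos (mul_pos h2 hu) h1
        _ = _ := by ring
    refine potential_sub_le (near a (Set.left_mem_Icc.2 (hau.trans hub).le)) ?_
      (near b (Set.right_mem_Icc.2 (hau.trans hub).le)) ?_
    · rw [planeCross_dir_path]; exact mul_neg_of_pos_of_neg hu (by linarith)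
    · rw [planeCross_dir_path]; exact mul_pos hu (by linarith)

/-- All slopes lie between `a` and `b`, so no contact line separates the end of one half turn from
the beginning of the next. -/
lemma potential_antipodal [Fintype ι] [Fintype P] (C : ContactSystem ι P E) {σ : ℝ} (hσ : σ ≠ 0)
    {a b : ℝ} (ha : ∀ u, a < C.slope u) (hb : ∀ u, C.slope u < b) :
    C.potential (σ, σ * b) = C.potential (-σ, -σ * a) := by
  refine potential_congr (fun e => hσ (congrArg Prod.fst e))
    (fun e => hσ (neg_eq_zero.1 (congrArg Prod.fst e))) fun v => ?_
  rw [planeCross_dir_path, planeCross_dir_path]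
  have h1 := mul_pos (sub_pos.2 (ha v)) (sub_pos.2 (hb v))
  have h2 : 0 < (σ * C.α (C.vec v)) ^ 2 := by
    have := C.α_vec_ne v
    positivity
  calc 0 < _ := mul_pos h2 h1
    _ = _ := by ring

/-- The number of contacts is at most the number of starts and ends of cones. -/
theorem card_le_sum_marks [Fintype ι] [Fintype P] (C : ContactSystem ι P E) :
    (Fintype.card ι : ℤ) ≤ ∑ u, C.marks u := by
  obtain ⟨a, ha⟩ : ∃ a, ∀ u, a < C.slope u := by
    obtain ⟨a, ha⟩ := (Set.finite_range C.slope).bddBelow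
    exact ⟨a - 1, fun u => by linarith [ha (Set.mem_range_self u)]⟩
  obtain ⟨b, hb⟩ : ∃ b, ∀ u, C.slope u < b := by
    obtain ⟨b, hb⟩ := (Set.finite_range C.slope).bddAbove
    exact ⟨b + 1, fun u => by linarith [hb (Set.mem_range_self u)]⟩
  rcases isEmpty_or_nonempty ι with hι | ⟨⟨u₀⟩⟩
  · simp
  have hab : a < b := (ha u₀).trans (hb u₀)
  -- The two half turns close up, so their potential changes add up to zero.
  have p1 := C.potential_path_sub_le one_ne_zero hab ha hb
  have p2 := C.potential_path_sub_le (neg_ne_zero.2 one_ne_zero) hab ha hb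
  have q1 := C.potential_antipodal one_ne_zero ha hb
  have q2 := C.potential_antipodal (neg_ne_zero.2 one_ne_zero) ha hb
  rw [neg_neg] at q2
  have hsplit : ∑ u with 0 < (1 : ℝ) * C.α (C.vec u), (2 * C.marks u - 2) +
      ∑ u with 0 < (-1 : ℝ) * C.α (C.vec u), (2 * C.marks u - 2) =
      ∑ u, (2 * C.marks u - 2) := by
    rw [← Finset.sum_filter_add_sum_filter_not Finset.univ
      (fun u => 0 < (1 : ℝ) * C.α (C.vec u)) (fun u => 2 * C.marks u - 2)]
    congr 1
    refine Finset.sum_congr (Finset.filter_congr fun u _ => ?_) fun _ _ => rfl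
    have := C.α_vec_ne u
    rw [one_mul, neg_one_mul, neg_pos, not_lt]
    exact ⟨le_of_lt, fun h => lt_of_le_of_ne h this⟩
  have htotal : ∑ u, (2 * C.marks u - 2) = 2 * ∑ u, C.marks u - Fintype.card ι * 2 := by
    rw [Finset.sum_sub_distrib, ← Finset.mul_sum, Finset.sum_const, Finset.card_univ,
      nsmul_eq_mul]
  linarith

lemma sum_le_card_of_unique [Fintype ι] (C : ContactSystem ι P E) (p : P → ι → Prop)
    [∀ X u, Decidable (p X u)] (hp : ∀ X u v, p X u → p X v → u = v) (T : Finset P)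
    (hT : ∀ X u, p X u → X ∈ T) :
    ∑ u, ((if p (C.red u) u then 1 else 0) + (if p (C.blue u) u then 1 else 0) : ℤ) ≤ T.card := by
  classical
  let R := Finset.univ.filter fun u => p (C.red u) u
  let B := Finset.univ.filter fun u => p (C.blue u) u
  have hR : (R.image C.red).card = R.card := Finset.card_image_of_injOn fun u hu v hv e => by
    simp only [R, Finset.coe_filter, Finset.mem_univ, true_and, Set.mem_ofPred_eq] at hu hv
    exact hp _ u v hu (by rw [show C.red u = C.red v from e]; exact hv)
  have hB : (B.image C.blue).card = B.card := Finset.card_image_of_injOn fun u hu v hv e => by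
    simp only [B, Finset.coe_filter, Finset.mem_univ, true_and, Set.mem_ofPred_eq] at hu hv
    exact hp _ u v hu (by rw [show C.blue u = C.blue v from e]; exact hv)
  have hd : Disjoint (R.image C.red) (B.image C.blue) := by
    rw [Finset.disjoint_left]
    intro X hX hX'
    obtain ⟨u, -, rfl⟩ := Finset.mem_image.1 hX
    obtain ⟨v, -, e⟩ := Finset.mem_image.1 hX'
    exact C.red_ne_blue u v e.symm
  have hsub : R.image C.red ∪ B.image C.blue ⊆ T := by
    refine Finset.union_subset ?_ ?_ <;> intro X hX <;> obtain ⟨u, hu, rfl⟩ := Finset.mem_image.1 hX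
    · exact hT _ u (Finset.mem_filter.1 hu).2
    · exact hT _ u (Finset.mem_filter.1 hu).2
  have := Finset.card_le_card hsub
  rw [Finset.card_union_of_disjoint hd, hR, hB] at this
  rw [Finset.sum_add_distrib, Finset.sum_boole, Finset.sum_boole]
  exact_mod_cast this

lemma IsStart.unique {X : P} {u v : ι} (h : C.IsStart X u) (h' : C.IsStart X v) : u = v := by
  by_contra hne
  have h1 := h.2 v h'.1 (Ne.symm hne)
  have h2 := h'.2 u h.1 hne
  rw [planeCross_swap] at h2
  linarith

lemma IsEnd.unique {X : P} {u v : ι} (h : C.IsEnd X u) (h' : C.IsEnd X v) : u = v := by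
  by_contra hne
  have h1 := h.2 v h'.1 (Ne.symm hne)
  have h2 := h'.2 u h.1 hne
  rw [planeCross_swap] at h2
  linarith

/-- A cone whose interior contains the axis has neither start nor end. -/
lemma not_isStart_isEnd {X : P} {v₁ v₂ v₃ : ι} (h₁ : C.Mem X v₁) (h₂ : C.Mem X v₂)
    (h₃ : C.Mem X v₃) (hne : v₁ ≠ v₂) {c₁ c₂ c₃ : ℝ} (p₁ : 0 < c₁) (p₂ : 0 < c₂) (p₃ : 0 < c₃)
    (hs : c₁ • C.dir v₁ + c₂ • C.dir v₂ + c₃ • C.dir v₃ = 0) (u : ι) :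
    ¬ C.IsStart X u ∧ ¬ C.IsEnd X u := by
  have e : c₁ * planeCross (C.dir u) (C.dir v₁) + c₂ * planeCross (C.dir u) (C.dir v₂) +
      c₃ * planeCross (C.dir u) (C.dir v₃) = 0 := by
    have e1 := congrArg Prod.fst hs
    have e2 := congrArg Prod.snd hs
    simp only [Prod.fst_add, Prod.snd_add, Prod.smul_fst, Prod.smul_snd, smul_eq_mul,
      Prod.fst_zero, Prod.snd_zero] at e1 e2
    simp only [planeCross]
    linear_combination (C.dir u).1 * e2 - (C.dir u).2 * e1
  constructor
  · intro h
    have nn : ∀ v, C.Mem X v → 0 ≤ planeCross (C.dir u) (C.dir v) := fun v hv => by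
      by_cases hvu : v = u
      · rw [hvu, planeCross_self]
      · exact (h.2 v hv hvu).le
    have n1 := mul_nonneg p₁.le (nn _ h₁)
    have n2 := mul_nonneg p₂.le (nn _ h₂)
    have n3 := mul_nonneg p₃.le (nn _ h₃)
    by_cases h1 : v₁ = u
    · have := mul_pos p₂ (h.2 v₂ h₂ (by rw [← h1]; exact hne.symm))
      linarith
    · have := mul_pos p₁ (h.2 v₁ h₁ h1)
      linarith
  · intro h
    have nn : ∀ v, C.Mem X v → planeCross (C.dir u) (C.dir v) ≤ 0 := fun v hv => by
      by_cases hvu : v = u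
      · rw [hvu, planeCross_self]
      · exact (h.2 v hv hvu).le
    have n1 := mul_nonpos_of_nonneg_of_nonpos p₁.le (nn _ h₁)
    have n2 := mul_nonpos_of_nonneg_of_nonpos p₂.le (nn _ h₂)
    have n3 := mul_nonpos_of_nonneg_of_nonpos p₃.le (nn _ h₃)
    by_cases h1 : v₁ = u
    · have := mul_neg_of_pos_of_neg p₂ (h.2 v₂ h₂ (by rw [← h1]; exact hne.symm))
      linarith
    · have := mul_neg_of_pos_of_neg p₁ (h.2 v₁ h₁ h1)
      linarith

/-- The number of contacts is at most twice the number of cones that do not surround the axis. -/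
theorem card_le_two_mul_card [Fintype ι] [Fintype P] (C : ContactSystem ι P E) (T : Finset P)
    (hT : ∀ X ∉ T, ∀ u, ¬ C.IsStart X u ∧ ¬ C.IsEnd X u) : Fintype.card ι ≤ 2 * T.card := by
  classical
  have h := C.card_le_sum_marks
  have h1 := C.sum_le_card_of_unique C.IsStart (fun _ _ _ => IsStart.unique) T
    fun X u hu => by_contra fun hX => (hT X hX u).1 hu
  have h2 := C.sum_le_card_of_unique C.IsEnd (fun _ _ _ => IsEnd.unique) T
    fun X u hu => by_contra fun hX => (hT X hX u).2 hu
  have h3 : ∑ u, C.marks u = _ := Finset.sum_add_distrib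
  have : (Fintype.card ι : ℤ) ≤ 2 * T.card := by
    calc (Fintype.card ι : ℤ) ≤ _ := h
      _ = _ := h3
      _ ≤ T.card + T.card := by
        refine add_le_add ?_ ?_
        · convert h1
        · convert h2
      _ = _ := by ring
  exact_mod_cast this

end ContactSystem

/-! ### Bilinear forms that keep cones from crossing. -/

section Cones

variable {V : Type*} [NormedAddCommGroup V] [InnerProductSpace ℝ V]

open RealInnerProductSpace

/-- A bilinear form that is nonnegative on two sets is nonnegative on the cones they span. -/
lemma nonneg_of_mem_hull (Q : V →ₗ[ℝ] V →ₗ[ℝ] ℝ) {A B : Set V}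
    (h : ∀ a ∈ A, ∀ b ∈ B, 0 ≤ Q a b) {a b : V} (ha : a ∈ PointedCone.hull ℝ A)
    (hb : b ∈ PointedCone.hull ℝ B) : 0 ≤ Q a b := by
  induction ha using Submodule.span_induction with
  | zero => simp
  | add x y _ _ hx hy => rw [map_add, LinearMap.add_apply]; exact add_nonneg hx hy
  | smul r x _ hx =>
    have : Q (r • x) b = (r : ℝ) * Q x b := by
      rw [show r • x = (r : ℝ) • x from rfl, map_smul, LinearMap.smul_apply, smul_eq_mul]
    rw [this]; exact mul_nonneg r.2 hx
  | mem a ha =>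
    induction hb using Submodule.span_induction with
    | zero => simp
    | add x y _ _ hx hy => rw [map_add]; exact add_nonneg hx hy
    | smul r x _ hx =>
      have : Q a (r • x) = (r : ℝ) * Q a x := by
        rw [show r • x = (r : ℝ) • x from rfl, map_smul, smul_eq_mul]
      rw [this]; exact mul_nonneg r.2 hx
    | mem b hb => exact h a ha b hb

lemma smul_or_neg_of_mem_hull {A : Set V} {c : V} (f : V →ₗ[ℝ] ℝ) (hc : f c = 0)
    (h : ∀ a ∈ A, a ≠ c → f a < 0) {a : V} (ha : a ∈ PointedCone.hull ℝ A) :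
    (∃ t : ℝ, 0 ≤ t ∧ a = t • c) ∨ f a < 0 := by
  induction ha using Submodule.span_induction with
  | zero => exact Or.inl ⟨0, le_rfl, by simp⟩
  | mem a ha =>
    by_cases e : a = c
    · exact Or.inl ⟨1, zero_le_one, by simp [e]⟩
    · exact Or.inr (h a ha e)
  | add x y _ _ hx hy =>
    rcases hx with ⟨s, hs, rfl⟩ | hx <;> rcases hy with ⟨t, ht, rfl⟩ | hy
    · exact Or.inl ⟨s + t, add_nonneg hs ht, (add_smul _ _ _).symm⟩
    · right; rw [map_add, map_smul, hc]; simpa using hy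
    · right; rw [map_add, map_smul, hc]; simpa using hx
    · right; rw [map_add]; linarith
  | smul r x _ hx =>
    rw [show r • x = (r : ℝ) • x from rfl]
    rcases hx with ⟨s, hs, rfl⟩ | hx
    · exact Or.inl ⟨r * s, mul_nonneg r.2 hs, smul_smul _ _ _⟩
    · rcases r.2.eq_or_lt with h0 | h0
      · exact Or.inl ⟨0, le_rfl, by rw [← h0]; simp⟩
      · right; rw [map_smul]; exact mul_neg_of_pos_of_neg h0 hx

/-- Two cones on whose generators, apart from a common null vector `c`, a positive semidefinite form
is negative do not cross outside the ray of `c`. -/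
lemma exists_eq_smul_of_add_eq_add (Q : V →ₗ[ℝ] V →ₗ[ℝ] ℝ) (hQ : ∀ z, 0 ≤ Q z z) {A B : Set V}
    {c : V} (hc : ∀ z, Q c z = 0) (hc' : ∀ z, Q z c = 0)
    (h : ∀ a ∈ A, ∀ b ∈ B, a ≠ c → b ≠ c → Q a b < 0) {a a' b b' : V}
    (ha : a ∈ PointedCone.hull ℝ A) (ha' : a' ∈ PointedCone.hull ℝ A)
    (hb : b ∈ PointedCone.hull ℝ B) (hb' : b' ∈ PointedCone.hull ℝ B) (e : a + a' = b + b') :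
    ∃ t : ℝ, 0 ≤ t ∧ (a = t • c ∨ a' = t • c ∨ b = t • c ∨ b' = t • c) := by
  by_contra hn
  push Not at hn
  have hneg : ∀ x ∈ PointedCone.hull ℝ A, ∀ y ∈ PointedCone.hull ℝ B,
      (∀ t : ℝ, 0 ≤ t → x ≠ t • c) → (∀ t : ℝ, 0 ≤ t → y ≠ t • c) → Q x y < 0 := by
    intro x hx y hy nx ny
    have h1 : ∀ a ∈ A, a ≠ c → Q a y < 0 := fun a ha hac =>
      (smul_or_neg_of_mem_hull (Q a) (hc' a) (fun b hb hbc => h a ha b hb hac hbc) hy).resolve_left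
        fun ⟨t, ht, e⟩ => ny t ht e
    exact (smul_or_neg_of_mem_hull (Q.flip y) (hc y) h1 hx).resolve_left
      fun ⟨t, ht, e⟩ => nx t ht e
  have na := fun t ht => (hn t ht).1
  have na' := fun t ht => (hn t ht).2.1
  have nb := fun t ht => (hn t ht).2.2.1
  have nb' := fun t ht => (hn t ht).2.2.2
  have h1 := hneg a ha b hb na nb
  have h2 := hneg a ha b' hb' na nb'
  have h3 := hneg a' ha' b hb na' nb
  have h4 := hneg a' ha' b' hb' na' nb'
  -- `Q (a + a') (a + a') = Q (a + a') (b + b')` would be both nonnegative and a sum of four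
  -- negative terms.
  have h5 := hQ (a + a')
  nth_rewrite 2 [e] at h5
  simp only [map_add, LinearMap.add_apply] at h5
  linarith

/-- The inner product of the components orthogonal to `e`, scaled by the square of the norm. -/
noncomputable def perpForm (e : V) : V →ₗ[ℝ] V →ₗ[ℝ] ℝ :=
  ‖e‖ ^ 2 • innerₗ V - (innerₗ V e).smulRight (innerₗ V e)

lemma perpForm_apply (e a b : V) : perpForm e a b = ‖e‖ ^ 2 * ⟪a, b⟫ - ⟪e, a⟫ * ⟪e, b⟫ := by
  simp [perpForm]

lemma perpForm_self_nonneg (e z : V) : 0 ≤ perpForm e z z := by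
  rw [perpForm_apply, real_inner_self_eq_norm_sq]
  have := abs_real_inner_le_norm e z
  have := abs_le_abs_of_nonneg (abs_nonneg _) this
  have h := sq_le_sq.2 this
  rw [sq_abs] at h
  nlinarith

lemma perpForm_left (e z : V) : perpForm e e z = 0 := by
  rw [perpForm_apply, real_inner_self_eq_norm_sq]; ring

lemma perpForm_right (e z : V) : perpForm e z e = 0 := by
  rw [perpForm_apply, real_inner_self_eq_norm_sq, real_inner_comm]; ring

lemma inner_sub_sub_of_dist {x a b : V} {D : ℝ} (ha : dist x a = D) (hb : dist x b = D)
    (hab : dist a b ≤ D) : D ^ 2 ≤ 2 * ⟪a - x, b - x⟫ := by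
  have h := norm_sub_sq_real (a - x) (b - x)
  rw [sub_sub_sub_cancel_right, ← dist_eq_norm, ← dist_eq_norm, ← dist_eq_norm, dist_comm a x,
    dist_comm b x, ha, hb] at h
  have := pow_le_pow_left₀ dist_nonneg hab 2
  linarith

lemma inner_sub_ge {x a y : V} {D : ℝ} (ha : dist x a = D) (hay : dist a y ≤ D) :
    ‖y - x‖ ^ 2 ≤ 2 * ⟪y - x, a - x⟫ := by
  have h := norm_sub_sq_real (a - x) (y - x)
  rw [sub_sub_sub_cancel_right, ← dist_eq_norm, ← dist_eq_norm, dist_comm a x, ha] at h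
  have := pow_le_pow_left₀ dist_nonneg hay 2
  rw [real_inner_comm]
  linarith

lemma inner_lt_of_norm_eq {a e : V} {D : ℝ} (ha : ‖a‖ = D) (he : ‖e‖ = D) (hne : a ≠ e) :
    ⟪e, a⟫ < D ^ 2 := by
  have h := norm_sub_sq_real e a
  have h0 : 0 < ‖e - a‖ := norm_pos_iff.2 (sub_ne_zero.2 hne.symm)
  rw [ha, he] at h
  have := pow_pos h0 2
  linarith

/-- The basic inequality between the diameters at `x` and at `y`. -/
lemma perpForm_neg {x y a b : V} {D : ℝ} (hxy : x ≠ y) (hD : dist x y ≤ D) (ha : dist x a = D)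
    (hb : dist b y = D) (hay : dist a y ≤ D) (hbx : dist b x ≤ D) (hab : dist a b ≤ D)
    (h : dist x y = D → a ≠ y ∧ b ≠ x) : perpForm (y - x) (a - x) (y - b) < 0 := by
  rw [perpForm_apply]
  have hr : 0 < ‖y - x‖ := norm_pos_iff.2 (sub_ne_zero.2 hxy.symm)
  have hrD : ‖y - x‖ ≤ D := by rwa [← dist_eq_norm, dist_comm]
  have na : ‖a - x‖ = D := by rw [← dist_eq_norm, dist_comm, ha]
  have nb : ‖y - b‖ = D := by rw [← dist_eq_norm, dist_comm, hb]
  have s1 := inner_sub_ge ha hay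
  have t1 : ‖y - x‖ ^ 2 ≤ 2 * ⟪y - x, y - b⟫ := by
    have := inner_sub_ge (x := y) (a := b) (y := x) (by rw [dist_comm, hb]) hbx
    rw [← neg_sub y x, ← neg_sub y b, inner_neg_neg, norm_neg] at this
    exact this
  have s2 : ⟪y - x, a - x⟫ ≤ ‖y - x‖ * D := by rw [← na]; exact real_inner_le_norm _ _
  have t2 : ⟪y - x, y - b⟫ ≤ ‖y - x‖ * D := by rw [← nb]; exact real_inner_le_norm _ _
  have key : 2 * ⟪a - x, y - b⟫ ≤
      2 * ⟪y - x, a - x⟫ + 2 * ⟪y - x, y - b⟫ - ‖y - x‖ ^ 2 - D ^ 2 := by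
    have e : a - b = (a - x) + (y - b) - (y - x) := by abel
    have h1 := norm_sub_sq_real ((a - x) + (y - b)) (y - x)
    rw [← e, ← dist_eq_norm, norm_add_sq_real, na, nb, inner_add_left,
      real_inner_comm (y - x) (a - x), real_inner_comm (y - x) (y - b)] at h1
    have := pow_le_pow_left₀ dist_nonneg hab 2
    linarith
  -- With `r = ‖y - x‖` and `s`, `t`, `q` the three inner products, `key` gives `2(r²q - st) ≤ -2(s
  -- - r²)(t - r²) - r²(D² - r²)`. For `r < D` the bounds `r²/2 ≤ s, t ≤ rD` suffice; for `r = D`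
  -- strictness comes from `s, t < D²`.
  rcases hrD.lt_or_eq with hlt | heq
  · generalize ⟪y - x, a - x⟫ = s at *
    generalize ⟪y - x, y - b⟫ = t at *
    generalize ⟪a - x, y - b⟫ = q at *
    generalize ‖y - x‖ = r at *
    have h1 : r ^ 2 * (2 * q) ≤ r ^ 2 * (2 * s + 2 * t - r ^ 2 - D ^ 2) :=
      mul_le_mul_of_nonneg_left key (by positivity)
    have h2 : -(2 * (s - r ^ 2) * (t - r ^ 2)) ≤ r ^ 3 * (D - r) := by
      rcases le_total (r ^ 2) s with hs | hs <;> rcases le_total (r ^ 2) t with ht | ht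
      · have := mul_nonneg (sub_nonneg.2 hs) (sub_nonneg.2 ht)
        have : 0 ≤ r ^ 3 * (D - r) := mul_nonneg (by positivity) (by linarith)
        linarith
      · have := mul_le_mul (show s - r ^ 2 ≤ r * (D - r) by linarith)
          (show r ^ 2 - t ≤ r ^ 2 / 2 by linarith) (by linarith)
          (mul_nonneg hr.le (by linarith))
        linarith
      · have := mul_le_mul (show t - r ^ 2 ≤ r * (D - r) by linarith)
          (show r ^ 2 - s ≤ r ^ 2 / 2 by linarith) (by linarith)
          (mul_nonneg hr.le (by linarith))
        linarith
      · have := mul_nonneg (sub_nonneg.2 hs) (sub_nonneg.2 ht)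
        have : 0 ≤ r ^ 3 * (D - r) := mul_nonneg (by positivity) (by linarith)
        linarith
    have h3 : r ^ 3 * (D - r) < r ^ 2 * (D ^ 2 - r ^ 2) := by
      have : 0 < r ^ 2 * (D - r) * D := by
        have : 0 < D - r := by linarith
        have : 0 < D := by linarith
        positivity
      linarith
    linarith
  · obtain ⟨hay', hbx'⟩ := h (by rw [dist_comm, dist_eq_norm, heq])
    have s3 := inner_lt_of_norm_eq na heq (fun e => hay' (sub_left_injective e))
    have t3 := inner_lt_of_norm_eq nb heq (fun e => hbx' (sub_right_injective e))
    rw [heq] at key ⊢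
    have h1 := mul_le_mul_of_nonneg_left key (sq_nonneg D)
    have h2 := mul_pos (sub_pos.2 s3) (sub_pos.2 t3)
    linarith

end Cones

/-! ### The contact system of the diameters. -/

section Diameters

variable {V : Type*} [NormedAddCommGroup V] [InnerProductSpace ℝ V]

open RealInnerProductSpace

/-- The ordered pairs of points of `S` at distance `D`. -/
abbrev DiamDart (S : Finset V) (D : ℝ) : Type _ := {q : S × S // dist (q.1 : V) (q.2 : V) = D}

/-- The vectors from `x` to the points at distance `D` for a red `x`, and their opposites for a
blue `x`. -/
def diamVectors (S : Finset V) (D : ℝ) : S × Bool → Set V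
  | (x, true) => {z | ∃ y ∈ S, dist (x : V) y = D ∧ z = y - x}
  | (x, false) => {z | ∃ y ∈ S, dist (x : V) y = D ∧ z = x - y}

/-- The cone of the vectors from `x` to the points at distance `D`, or its opposite. -/
def diamCone (S : Finset V) (D : ℝ) (X : S × Bool) : PointedCone ℝ V :=
  PointedCone.hull ℝ (diamVectors S D X)

/-- The contact of two cones attached to a pair of points at distance `D`. -/
def DiamContact {S : Finset V} {D : ℝ} (X Y : S × Bool) (u : DiamDart S D) : Prop :=
  (u.1.1, true) = X ∧ (u.1.2, false) = Y ∨ (u.1.1, true) = Y ∧ (u.1.2, false) = X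

variable {S : Finset V} {D : ℝ}

lemma inner_nonneg_of_mem_diamCone (hS : ∀ x ∈ S, ∀ y ∈ S, dist x y ≤ D) {X : S × Bool} {a b : V}
    (ha : a ∈ diamCone S D X) (hb : b ∈ diamCone S D X) : 0 ≤ ⟪a, b⟫ := by
  refine nonneg_of_mem_hull (innerₗ V) ?_ ha hb
  rcases X with ⟨x, _ | _⟩ <;> rintro _ ⟨y, hy, hxy, rfl⟩ _ ⟨z, hz, hxz, rfl⟩ <;>
    have := inner_sub_sub_of_dist hxy hxz (hS y hy z hz) <;> have := sq_nonneg D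
  · rw [innerₗ_apply_apply, ← neg_sub y, ← neg_sub z, inner_neg_neg]
    linarith
  · rw [innerₗ_apply_apply]
    linarith

lemma diamCone_salient (hS : ∀ x ∈ S, ∀ y ∈ S, dist x y ≤ D) {X : S × Bool} {a b : V}
    (ha : a ∈ diamCone S D X) (hb : b ∈ diamCone S D X) (h : a + b = 0) : a = 0 := by
  have h1 := inner_nonneg_of_mem_diamCone hS ha hb
  rw [eq_neg_of_add_eq_zero_right h, inner_neg_right] at h1
  exact inner_self_eq_zero.1 (le_antisymm (by linarith) real_inner_self_nonneg)

lemma inner_pos_of_dist {x y a : V} (hxy : x ≠ y) (ha : dist x a = D) (hay : dist a y ≤ D) :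
    0 < ⟪y - x, a - x⟫ := by
  have := inner_sub_ge ha hay
  have := pow_pos (norm_pos_iff.2 (sub_ne_zero.2 hxy.symm)) 2
  linarith

/-- The functional `⟪y - x, ·⟫` has opposite strict signs on the generators of the two cones, so its
square serves as the form. -/
lemma not_add_eq_add_of_fst_ne (hS : ∀ x ∈ S, ∀ y ∈ S, dist x y ≤ D) {x y : S} (hxy : x ≠ y)
    (c : Bool) {a a' b b' : V}
    (ha : a ∈ diamCone S D (x, c)) (ha' : a' ∈ diamCone S D (x, c))
    (hb : b ∈ diamCone S D (y, c)) (hb' : b' ∈ diamCone S D (y, c))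
    (a0 : a ≠ 0) (a0' : a' ≠ 0) (b0 : b ≠ 0) (b0' : b' ≠ 0) : a + a' ≠ b + b' := by
  intro e
  have hne : (x : V) ≠ y := fun h => hxy (Subtype.ext h)
  obtain ⟨t, -, h⟩ := exists_eq_smul_of_add_eq_add
    ((innerₗ V (y - x : V)).smulRight (innerₗ V (y - x : V)))
    (fun z => by simpa using mul_self_nonneg _) (c := 0) (by simp) (by simp) (by
      rcases c with _ | _ <;> rintro _ ⟨p, hp, hxp, rfl⟩ _ ⟨q, hq, hyq, rfl⟩ - - <;>
        have h1 := inner_pos_of_dist hne hxp (hS p hp y y.2) <;>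
        have h2 := inner_pos_of_dist hne.symm hyq (hS q hq x x.2) <;>
        rw [← neg_sub (y : V) (x : V), inner_neg_left] at h2 <;>
        simp only [LinearMap.smulRight_apply, LinearMap.smul_apply, innerₗ_apply_apply,
          smul_eq_mul]
      · rw [← neg_sub p, ← neg_sub q, inner_neg_right, inner_neg_right]
        nlinarith
      · nlinarith) ha ha' hb hb' e
  simp only [smul_zero] at h
  tauto

/-- The form is the inner product if `x = y`, and `perpForm (y - x)` otherwise; the exceptional null
vector is `y - x` for a diameter and `0` in the other cases. -/
lemma exists_contact_red_blue (hD : 0 < D) (hS : ∀ x ∈ S, ∀ y ∈ S, dist x y ≤ D) {x y : S}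
    {a a' b b' : V} (ha : a ∈ diamCone S D (x, true)) (ha' : a' ∈ diamCone S D (x, true))
    (hb : b ∈ diamCone S D (y, false)) (hb' : b' ∈ diamCone S D (y, false))
    (a0 : a ≠ 0) (a0' : a' ≠ 0) (b0 : b ≠ 0) (b0' : b' ≠ 0) (e : a + a' = b + b') :
    dist (x : V) y = D ∧ ∃ t : ℝ, 0 ≤ t ∧ (a = t • (y - x : V) ∨ a' = t • (y - x : V) ∨
      b = t • (y - x : V) ∨ b' = t • (y - x : V)) := by
  by_cases hxy : x = y
  · subst hxy
    obtain ⟨t, -, h⟩ := exists_eq_smul_of_add_eq_add (innerₗ V)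
      (fun z => by simp) (c := 0) (by simp) (by simp) (by
        rintro _ ⟨p, hp, hxp, rfl⟩ _ ⟨q, hq, hxq, rfl⟩ - -
        have := inner_sub_sub_of_dist hxp hxq (hS p hp q hq)
        have := pow_pos hD 2
        rw [innerₗ_apply_apply, ← neg_sub q, inner_neg_right]
        linarith) ha ha' hb hb' e
    simp only [smul_zero] at h
    tauto
  have hne : (x : V) ≠ y := fun h => hxy (Subtype.ext h)
  by_cases hd : dist (x : V) y = D
  · refine ⟨hd, ?_⟩
    refine exists_eq_smul_of_add_eq_add (perpForm (y - x : V)) (perpForm_self_nonneg _)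
      (perpForm_left _) (perpForm_right _) ?_ ha ha' hb hb' e
    rintro _ ⟨p, hp, hxp, rfl⟩ _ ⟨q, hq, hyq, rfl⟩ h1 h2
    refine perpForm_neg hne hd.le hxp (by rw [dist_comm, hyq]) (hS p hp y y.2) (hS q hq x x.2)
      (hS p hp q hq) fun _ => ⟨?_, ?_⟩
    · rintro rfl; exact h1 rfl
    · rintro rfl; exact h2 rfl
  · obtain ⟨t, -, h⟩ := exists_eq_smul_of_add_eq_add (perpForm (y - x : V))
      (perpForm_self_nonneg _) (c := 0) (by simp) (by simp) (by
        rintro _ ⟨p, hp, hxp, rfl⟩ _ ⟨q, hq, hyq, rfl⟩ - -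
        exact perpForm_neg hne (hS x x.2 y y.2) hxp (by rw [dist_comm, hyq]) (hS p hp y y.2)
          (hS q hq x x.2) (hS p hp q hq) fun h => absurd h hd) ha ha' hb hb' e
    simp only [smul_zero] at h
    tauto

lemma diamCone_noncrossing (hD : 0 < D) (hS : ∀ x ∈ S, ∀ y ∈ S, dist x y ≤ D) {X Y : S × Bool}
    (hXY : X ≠ Y) {a a' b b' : V} (ha : a ∈ diamCone S D X) (ha' : a' ∈ diamCone S D X)
    (hb : b ∈ diamCone S D Y) (hb' : b' ∈ diamCone S D Y)
    (a0 : a ≠ 0) (a0' : a' ≠ 0) (b0 : b ≠ 0) (b0' : b' ≠ 0) (e : a + a' = b + b') :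
    ∃ u : DiamDart S D, DiamContact X Y u ∧ ∃ t : ℝ, 0 ≤ t ∧
      (a = t • (u.1.2 - u.1.1 : V) ∨ a' = t • (u.1.2 - u.1.1 : V) ∨
        b = t • (u.1.2 - u.1.1 : V) ∨ b' = t • (u.1.2 - u.1.1 : V)) := by
  obtain ⟨x, c⟩ := X
  obtain ⟨y, c'⟩ := Y
  by_cases hc : c = c'
  · subst hc
    exact absurd e (not_add_eq_add_of_fst_ne hS (fun h => hXY (by rw [h])) c ha ha' hb hb'
      a0 a0' b0 b0')
  rcases c with _ | _ <;> rcases c' with _ | _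
  · exact absurd rfl hc
  · obtain ⟨h, t, ht, h'⟩ := exists_contact_red_blue hD hS hb hb' ha ha' b0 b0' a0 a0' e.symm
    exact ⟨⟨(y, x), h⟩, Or.inr ⟨rfl, rfl⟩, t, ht, by tauto⟩
  · obtain ⟨h, t, ht, h'⟩ := exists_contact_red_blue hD hS ha ha' hb hb' a0 a0' b0 b0' e
    exact ⟨⟨(x, y), h⟩, Or.inl ⟨rfl, rfl⟩, t, ht, h'⟩
  · exact absurd rfl hc

lemma neg_mem_diamCone {x : S} {c : Bool} {a : V} (ha : a ∈ diamCone S D (x, c)) :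
    -a ∈ diamCone S D (x, !c) := by
  induction ha using Submodule.span_induction with
  | zero => rw [neg_zero]; exact zero_mem _
  | add x y _ _ hx hy => rw [neg_add]; exact add_mem hx hy
  | smul r x _ hx => rw [← smul_neg]; exact Submodule.smul_mem _ r hx
  | mem a ha =>
    refine PointedCone.subset_hull ?_
    rcases c with _ | _ <;> obtain ⟨y, hy, hxy, rfl⟩ := ha <;>
      exact ⟨y, hy, hxy, neg_sub _ _⟩

/-- If the tails differed, the functional given by their difference would take both signs on the
common vector. -/
lemma eq_of_sub_eq_sub (hS : ∀ x ∈ S, ∀ y ∈ S, dist x y ≤ D) {u v : DiamDart S D}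
    (h : (u.1.2 - u.1.1 : V) = v.1.2 - v.1.1) : u = v := by
  have h1 : u.1.1 = v.1.1 := by
    by_contra hne
    have hne' : (u.1.1 : V) ≠ v.1.1 := fun h => hne (Subtype.ext h)
    have p1 := inner_pos_of_dist hne' u.2 (hS _ u.1.2.2 _ v.1.1.2)
    have p2 := inner_pos_of_dist hne'.symm v.2 (hS _ v.1.2.2 _ u.1.1.2)
    rw [← h, ← neg_sub (v.1.1 : V) (u.1.1 : V), inner_neg_left] at p2
    linarith
  rw [h1] at h
  exact Subtype.ext (Prod.ext h1 (Subtype.ext (sub_left_injective h)))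

/-- The two cones of a diameter do not both meet the axis. -/
lemma diamCone_no_polar (hD : 0 < D) (hS : ∀ x ∈ S, ∀ y ∈ S, dist x y ≤ D) {α β η : V →ₗ[ℝ] ℝ}
    (hz : ∀ z, α z = 0 → β z = 0 → η z = 0 → z = 0)
    (hα : ∀ u : DiamDart S D, α (u.1.2 - u.1.1 : V) ≠ 0) {u : DiamDart S D}
    {a b : V} (ha : a ∈ diamCone S D (u.1.1, true)) (hb : b ∈ diamCone S D (u.1.2, false))
    (a0 : a ≠ 0) (b0 : b ≠ 0) (aα : α a = 0) (aβ : β a = 0) (bα : α b = 0) (bβ : β b = 0) :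
    False := by
  have ηa : η a ≠ 0 := fun h => a0 (hz a aα aβ h)
  have ηb : η b ≠ 0 := fun h => b0 (hz b bα bβ h)
  have hab : b = (η b / η a) • a := by
    refine sub_eq_zero.1 (hz _ ?_ ?_ ?_)
    · rw [map_sub, map_smul, aα, bα, smul_zero, sub_zero]
    · rw [map_sub, map_smul, aβ, bβ, smul_zero, sub_zero]
    · rw [map_sub, map_smul, smul_eq_mul, div_mul_cancel₀ _ ηa, sub_self]
  -- A vector common to two distinct cones lies on a contact ray, but `α` vanishes on the axis and
  -- not on contact vectors.
  have key : ∀ (Y : S × Bool) (s : ℝ), (u.1.1, true) ≠ Y → 0 < s → s • a ∈ diamCone S D Y →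
      False := by
    intro Y s hY hs hb
    have sa := (diamCone S D (u.1.1, true)).smul_mem hs.le ha
    have s0 : s • a ≠ 0 := smul_ne_zero hs.ne' a0
    obtain ⟨v, -, t, -, h⟩ := diamCone_noncrossing hD hS hY sa sa hb hb s0 s0 s0 s0 rfl
    simp only [or_self] at h
    have h1 := congrArg α h
    rw [map_smul, map_smul, aα, smul_zero, eq_comm, smul_eq_zero] at h1
    rcases h1 with h1 | h1
    · rw [h1, zero_smul] at h
      exact s0 h
    · exact hα v h1
  -- If `a` and `b` point in opposite directions along the axis, `-b` in the red cone of the second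
  -- endpoint replaces `b`.
  rcases lt_or_gt_of_ne (div_ne_zero ηb ηa) with hs | hs
  · refine key (u.1.2, true) (-(η b / η a)) ?_ (neg_pos.2 hs) ?_
    · intro h
      have := u.2
      rw [show u.1.1 = u.1.2 from (Prod.mk.inj h).1, dist_self] at this
      exact hD.ne this
    · rw [neg_smul, ← hab]
      have := neg_mem_diamCone hb
      rwa [Bool.not_false] at this
  · refine key (u.1.2, false) (η b / η a) (by simp) hs ?_
    rw [← hab]
    exact hb

/-- The contact system of the diameters of a finite set, in generic coordinates. -/
def diamSystem (hD : 0 < D) (hS : ∀ x ∈ S, ∀ y ∈ S, dist x y ≤ D) (α β η : V →ₗ[ℝ] ℝ)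
    (hz : ∀ z, α z = 0 → β z = 0 → η z = 0 → z = 0)
    (hα : ∀ u : DiamDart S D, α (u.1.2 - u.1.1 : V) ≠ 0)
    (hg : ∀ u v : DiamDart S D, α (u.1.2 - u.1.1 : V) * β (v.1.2 - v.1.1 : V) =
      β (u.1.2 - u.1.1 : V) * α (v.1.2 - v.1.1 : V) →
        ∃ k : ℝ, (v.1.2 - v.1.1 : V) = k • (u.1.2 - u.1.1 : V)) :
    ContactSystem (DiamDart S D) (S × Bool) V where
  vec u := u.1.2 - u.1.1
  red u := (u.1.1, true)
  blue u := (u.1.2, false)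
  K := diamCone S D
  α := α
  β := β
  η := η
  vec_mem_red u := PointedCone.subset_hull ⟨u.1.2, u.1.2.2, u.2, rfl⟩
  vec_mem_blue u := PointedCone.subset_hull ⟨u.1.1, u.1.1.2, by rw [dist_comm, u.2], rfl⟩
  red_ne_blue u v h := Bool.noConfusion (congrArg Prod.snd h)
  eq_of_contact u v h h' := Subtype.ext (Prod.ext (Prod.mk.inj h).1 (Prod.mk.inj h').1)
  eq_zero_of_coords := hz
  α_vec_ne := hα
  opp u := ⟨⟨(u.1.2, u.1.1), by rw [dist_comm, u.2]⟩, (neg_sub _ _).symm⟩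
  generic u v huv h := by
    obtain ⟨k, hk⟩ := hg u v h
    have nu : ‖(u.1.2 - u.1.1 : V)‖ = D := by rw [← dist_eq_norm, dist_comm, u.2]
    have nv : ‖(v.1.2 - v.1.1 : V)‖ = D := by rw [← dist_eq_norm, dist_comm, v.2]
    rw [hk, norm_smul, nu, Real.norm_eq_abs] at nv
    rcases eq_or_eq_neg_of_abs_eq (mul_right_cancel₀ hD.ne' (nv.trans (one_mul D).symm)) with e | e
    · rw [e, one_smul] at hk
      exact absurd (eq_of_sub_eq_sub hS hk.symm) huv
    · rw [hk, e, neg_one_smul]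
  salient X a ha b hb := diamCone_salient hS ha hb
  noncrossing X Y hXY a ha a' ha' b hb b' hb' := diamCone_noncrossing hD hS hXY ha ha' hb hb'
  no_polar u a ha b hb := diamCone_no_polar hD hS hz hα ha hb

end Diameters

/-! ### A generic axis inside a given cone. -/

section Generic

open Polynomial in
lemma coeffs_eq_zero_of_quadratic_eq_zero {p q r : ℝ}
    (h : (C p + C q * X + C r * X ^ 2 : ℝ[X]) = 0) : p = 0 ∧ q = 0 ∧ r = 0 := by
  have c0 := congrArg (coeff · 0) h
  have c1 := congrArg (coeff · 1) h
  have c2 := congrArg (coeff · 2) h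
  simp [coeff_X, coeff_C, coeff_X_pow] at c0 c1 c2
  exact ⟨c0, c1, c2⟩

/-- In three dimensions there are coordinates `α`, `β`, `η` such that the common kernel of `α` and
`β` is spanned by a positive combination of given basis vectors, and such that this axis is in
general position with respect to given vectors. -/
lemma exists_generic_coords {V : Type*} [AddCommGroup V] [Module ℝ V]
    (b : Module.Basis (Fin 3) ℝ V) {W : Set V} (hW : W.Finite) (h0 : ∀ w ∈ W, w ≠ 0) :
    ∃ (α β η : V →ₗ[ℝ] ℝ) (c : Fin 3 → ℝ), (∀ i, 0 < c i) ∧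
      (∀ z, α z = 0 → β z = 0 → η z = 0 → z = 0) ∧
      α (∑ i, c i • b i) = 0 ∧ β (∑ i, c i • b i) = 0 ∧ (∀ w ∈ W, α w ≠ 0) ∧
      ∀ v ∈ W, ∀ w ∈ W, α v * β w = β v * α w → ∃ k : ℝ, w = k • v := by
  open Polynomial in
  have n1 : ∀ w ∈ W, (C (b.coord 1 w) - C (b.coord 0 w) * X + C (b.coord 2 w) * X ^ 2 -
      C (b.coord 1 w) * X ^ 3 : ℝ[X]) ≠ 0 := by
    intro w hw e
    refine h0 w hw (b.ext_elem fun i => ?_)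
    have c0 := congrArg (coeff · 0) e
    have c1 := congrArg (coeff · 1) e
    have c2 := congrArg (coeff · 2) e
    simp [coeff_X, coeff_C, coeff_X_pow] at c0 c1 c2
    fin_cases i <;> simp [c0, c1, c2]
  open Polynomial in
  have n2 : ∀ v ∈ W, ∀ w ∈ W, (¬ ∃ k : ℝ, w = k • v) →
      (C (b.coord 1 v * b.coord 2 w - b.coord 2 v * b.coord 1 w) +
        C (b.coord 2 v * b.coord 0 w - b.coord 0 v * b.coord 2 w) * X +
        C (b.coord 0 v * b.coord 1 w - b.coord 1 v * b.coord 0 w) * X ^ 2 : ℝ[X]) ≠ 0 := by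
    intro v hv w hw hk e
    obtain ⟨c0, c1, c2⟩ := coeffs_eq_zero_of_quadratic_eq_zero e
    simp only [Module.Basis.coord_apply] at c0 c1 c2
    obtain ⟨i, hi⟩ : ∃ i, b.repr v i ≠ 0 := by
      by_contra hn
      push Not at hn
      exact h0 v hv (b.ext_elem fun i => by simp [hn i])
    refine hk ⟨b.repr w i / b.repr v i, b.ext_elem fun j => ?_⟩
    simp only [map_smul, Finsupp.smul_apply, smul_eq_mul]
    field_simp
    fin_cases i <;> fin_cases j <;> simp <;> linarith
  have ev : ∀ᶠ t : ℝ in Filter.atTop, 0 < t ∧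
      (∀ w ∈ W, b.coord 1 w - b.coord 0 w * t + b.coord 2 w * t ^ 2 - b.coord 1 w * t ^ 3 ≠ 0) ∧
      ∀ v ∈ W, ∀ w ∈ W, (¬ ∃ k : ℝ, w = k • v) →
        (b.coord 1 v * b.coord 2 w - b.coord 2 v * b.coord 1 w) +
        (b.coord 2 v * b.coord 0 w - b.coord 0 v * b.coord 2 w) * t +
        (b.coord 0 v * b.coord 1 w - b.coord 1 v * b.coord 0 w) * t ^ 2 ≠ 0 := by
    refine (Filter.eventually_gt_atTop 0).and (Filter.Eventually.and ?_ ?_)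
    · refine (Filter.eventually_all_finite hW).2 fun w hw => ?_
      filter_upwards [Polynomial.eventually_atTop_not_isRoot _ (n1 w hw)] with t ht
      simpa [Polynomial.IsRoot] using ht
    · refine (Filter.eventually_all_finite hW).2 fun v hv =>
        (Filter.eventually_all_finite hW).2 fun w hw => Filter.eventually_imp_distrib_left.2
          fun hk => ?_
      filter_upwards [Polynomial.eventually_atTop_not_isRoot _ (n2 v hv w hw hk)] with t ht
      simpa [Polynomial.IsRoot] using ht
  obtain ⟨t, ht, h1, h2⟩ := ev.exists
  -- The axis is spanned by `(1, t, t²)`, and `α = (coord 1 - t coord 0) + t² β`. The multiple of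
  -- `β` makes all coordinates of `w` coefficients of the polynomial `α w` in `t`. The form `α v * β
  -- w - β v * α w` is the determinant of `(1, t, t²)`, `v`, `w`. A large `t` avoids all the roots.
  refine ⟨b.coord 1 - t • b.coord 0 + t ^ 2 • b.coord 2 - t ^ 3 • b.coord 1,
    b.coord 2 - t • b.coord 1, b.coord 0, fun i => t ^ (i : ℕ), fun i => by positivity,
    ?_, ?_, ?_, ?_, ?_⟩
  · intro z hα hβ hη
    simp only [LinearMap.sub_apply, LinearMap.add_apply, LinearMap.smul_apply, smul_eq_mul,
      hη] at hα hβ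
    have e1 : b.coord 1 z = 0 := by linear_combination hα - t ^ 2 * hβ
    have e2 : b.coord 2 z = 0 := by linear_combination hβ + t * e1
    refine b.ext_elem fun i => ?_
    simp only [Module.Basis.coord_apply] at hη e1 e2
    fin_cases i <;> simp [hη, e1, e2]
  · simp [Fin.sum_univ_three]
    ring
  · simp [Fin.sum_univ_three]
    ring
  · intro w hw h
    refine h1 w hw ?_
    simp only [LinearMap.sub_apply, LinearMap.add_apply, LinearMap.smul_apply, smul_eq_mul] at h
    linarith
  · intro v hv w hw h
    by_contra hk
    refine h2 v hv w hw hk ?_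
    simp only [LinearMap.sub_apply, LinearMap.add_apply, LinearMap.smul_apply, smul_eq_mul] at h
    linear_combination h

end Generic

/-! ### Minimum degree three and the induction on the number of points. -/

/-- The number of ordered pairs of points of `S` at distance `D` in terms of a smaller set. -/
lemma card_pairs_erase_le {V : Type*} [PseudoMetricSpace V] [DecidableEq V] (S : Finset V)
    (D : ℝ) (x : V) :
    ((S ×ˢ S).filter fun q => dist q.1 q.2 = D).card ≤
      ((S.erase x ×ˢ S.erase x).filter fun q => dist q.1 q.2 = D).card +
        2 * (S.filter fun y => dist x y = D).card := by
  have hsub : (S ×ˢ S).filter (fun q => dist q.1 q.2 = D) ⊆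
      ((S.erase x ×ˢ S.erase x).filter fun q => dist q.1 q.2 = D) ∪
        ((S.filter fun y => dist x y = D).image (fun y => (x, y)) ∪
          (S.filter fun y => dist x y = D).image (fun y => (y, x))) := by
    rintro ⟨a, b⟩ h
    simp only [Finset.mem_filter, Finset.mem_product, Finset.mem_union, Finset.mem_image,
      Finset.mem_erase, Prod.mk.injEq] at h ⊢
    by_cases ha : a = x
    · right; left; exact ⟨b, ⟨h.1.2, by rw [← ha]; exact h.2⟩, ha.symm, rfl⟩
    by_cases hb : b = x
    · right; right; exact ⟨a, ⟨h.1.1, by rw [← hb, dist_comm]; exact h.2⟩, rfl, hb.symm⟩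
    · left; exact ⟨⟨⟨ha, h.1.1⟩, hb, h.1.2⟩, h.2⟩
  refine (Finset.card_le_card hsub).trans ((Finset.card_union_le _ _).trans ?_)
  refine Nat.add_le_add_left ((Finset.card_union_le _ _).trans ?_) _
  have h1 := Finset.card_image_le (s := S.filter fun y => dist x y = D) (f := fun y => (x, y))
  have h2 := Finset.card_image_le (s := S.filter fun y => dist x y = D) (f := fun y => (y, x))
  omega

section Diameters

variable {V : Type*} [NormedAddCommGroup V] [InnerProductSpace ℝ V] {S : Finset V} {D : ℝ}

/-- Pairing with `w - v` under `perpForm (w - x)` kills `w - x` and is negative on `y - x` and `z -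
x`, so `a` and `b` cannot balance when they have no opposite signs. -/
lemma eq_zero_of_combination (hS : ∀ x ∈ S, ∀ y ∈ S, dist x y ≤ D) (hD : 0 < D)
    {x y z w v : V} (hx : x ∈ S) (hy : y ∈ S) (hz : z ∈ S) (hw : w ∈ S) (hv : v ∈ S)
    (xy : dist x y = D) (xz : dist x z = D) (xw : dist x w = D) (wv : dist v w = D)
    (hvx : v ≠ x) (hyw : y ≠ w) (hzw : z ≠ w) {a b c : ℝ} (hab : 0 ≤ a * b)
    (h : a • (y - x) + b • (z - x) + c • (w - x) = 0) : a = 0 ∧ b = 0 ∧ c = 0 := by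
  have hxw : x ≠ w := by rintro rfl; rw [dist_self] at xw; exact hD.ne xw
  have q1 := perpForm_neg hxw xw.le xy wv (hS y hy w hw) (hS v hv x hx) (hS y hy v hv)
    fun _ => ⟨hyw, hvx⟩
  have q2 := perpForm_neg hxw xw.le xz wv (hS z hz w hw) (hS v hv x hx) (hS z hz v hv)
    fun _ => ⟨hzw, hvx⟩
  have e := congrArg (fun u => perpForm (w - x) u (w - v)) h
  simp only [map_add, map_smul, LinearMap.add_apply, LinearMap.smul_apply, smul_eq_mul,
    perpForm_left, mul_zero, add_zero, map_zero, LinearMap.zero_apply] at e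
  generalize perpForm (w - x) (y - x) (w - v) = p at *
  generalize perpForm (w - x) (z - x) (w - v) = q at *
  have ha : a = 0 := by
    by_contra ha
    have h1 : a * a * p < 0 := mul_neg_of_pos_of_neg (mul_self_pos.2 ha) q1
    have h2 : a * b * q ≤ 0 := mul_nonpos_of_nonneg_of_nonpos hab q2.le
    have h3 : a * (a * p + b * q) = 0 := by rw [e, mul_zero]
    linarith
  have hb : b = 0 := by
    rw [ha, zero_mul, zero_add] at e
    exact (mul_eq_zero.1 e).resolve_right q2.ne
  refine ⟨ha, hb, ?_⟩
  rw [ha, hb, zero_smul, zero_smul, zero_add, zero_add] at h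
  exact (smul_eq_zero.1 h).resolve_right (sub_ne_zero.2 hxw.symm)

/-- Among three real coefficients some two have a nonnegative product, and `eq_zero_of_combination`
applies with the third vector in the role of `w - x`. -/
lemma linearIndependent_of_dist (hS : ∀ x ∈ S, ∀ y ∈ S, dist x y ≤ D) (hD : 0 < D)
    {x : V} (hx : x ∈ S) {y : Fin 3 → V} (hy : ∀ i, y i ∈ S) (hxy : ∀ i, dist x (y i) = D)
    (hinj : Function.Injective y) (hn : ∀ i, ∃ v ∈ S, dist v (y i) = D ∧ v ≠ x) :
    LinearIndependent ℝ fun i => y i - x := by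
  rw [Fintype.linearIndependent_iff]
  intro g hg
  rw [Fin.sum_univ_three] at hg
  have key : ∀ i j k, i ≠ k → j ≠ k → 0 ≤ g i * g j →
      g i • (y i - x) + g j • (y j - x) + g k • (y k - x) = 0 → g i = 0 ∧ g j = 0 ∧ g k = 0 := by
    intro i j k hik hjk hij h
    obtain ⟨v, hv, hvk, hvx⟩ := hn k
    exact eq_zero_of_combination hS hD hx (hy i) (hy j) (hy k) hv (hxy i) (hxy j) (hxy k) hvk hvx
      (hinj.ne hik) (hinj.ne hjk) hij h
  have all : g 0 = 0 ∧ g 1 = 0 ∧ g 2 = 0 := by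
    rcases le_or_gt 0 (g 0 * g 1) with h | h
    · exact key 0 1 2 (by decide) (by decide) h hg
    rcases le_or_gt 0 (g 1 * g 2) with h' | h'
    · have := key 1 2 0 (by decide) (by decide) h' (by rw [← hg]; abel)
      tauto
    rcases le_or_gt 0 (g 0 * g 2) with h'' | h''
    · have := key 0 2 1 (by decide) (by decide) h'' (by rw [← hg]; abel)
      tauto
    have h1 := mul_neg_of_pos_of_neg (mul_pos_of_neg_of_neg h h') h''
    have h2 := sq_nonneg (g 0 * g 1 * g 2)
    linarith
  intro i
  fin_cases i
  · exact all.1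
  · exact all.2.1
  · exact all.2.2

/-- The bound for the number of diameters of a set in which every point has three diameters. -/
lemma card_diamDart_le_of_degree (hdim : Module.finrank ℝ V = 3) (hD : 0 < D)
    (hS : ∀ x ∈ S, ∀ y ∈ S, dist x y ≤ D)
    (hdeg : ∀ x ∈ S, 2 < (S.filter fun y => dist x y = D).card) (hne : S.Nonempty) :
    Nat.card (DiamDart S D) + 4 ≤ 4 * S.card := by
  classical
  obtain ⟨x, hx⟩ := hne
  obtain ⟨y₀, h₀, y₁, h₁, y₂, h₂, h₀₁, h₀₂, h₁₂⟩ := Finset.two_lt_card.1 (hdeg x hx)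
  simp only [Finset.mem_filter] at h₀ h₁ h₂
  let y : Fin 3 → V := ![y₀, y₁, y₂]
  have hy : ∀ i, y i ∈ S := by intro i; fin_cases i <;> simp [y, h₀, h₁, h₂]
  have hxy : ∀ i, dist x (y i) = D := by intro i; fin_cases i <;> simp [y, h₀, h₁, h₂]
  have hinj : Function.Injective y := by
    intro i j; fin_cases i <;> fin_cases j <;> simp [y, h₀₁, h₀₂, h₁₂, h₀₁.symm, h₀₂.symm, h₁₂.symm]
  have li := linearIndependent_of_dist hS hD hx hy hxy hinj fun i => by
    obtain ⟨v, hv, hvx⟩ := Finset.exists_mem_ne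
      (one_lt_two.trans (hdeg (y i) (hy i))) x
    rw [Finset.mem_filter] at hv
    exact ⟨v, hv.1, by rw [dist_comm, hv.2], hvx⟩
  let b := basisOfLinearIndependentOfCardEqFinrank li (by simp [hdim])
  have hb : ∀ i, b i = y i - x := fun i => by
    simp [b]
  have vec_ne : ∀ u : DiamDart S D, (u.1.2 - u.1.1 : V) ≠ 0 := by
    intro u e
    have := u.2
    rw [sub_eq_zero.1 e, dist_self] at this
    exact hD.ne this
  obtain ⟨α, β, η, c, hc, hz, pα, pβ, hα, hg⟩ := exists_generic_coords b
    (Set.finite_range fun u : DiamDart S D => (u.1.2 - u.1.1 : V))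
    (by rintro _ ⟨u, rfl⟩; exact vec_ne u)
  let C := diamSystem hD hS α β η hz (fun u => hα _ ⟨u, rfl⟩)
    (fun u v => hg _ ⟨u, rfl⟩ _ ⟨v, rfl⟩)
  let x' : S := ⟨x, hx⟩
  let v : Fin 3 → DiamDart S D := fun i => ⟨(x', ⟨y i, hy i⟩), hxy i⟩
  let v' : Fin 3 → DiamDart S D := fun i => ⟨(⟨y i, hy i⟩, x'), by rw [dist_comm]; exact hxy i⟩
  rw [Fin.sum_univ_three, hb, hb, hb] at pα pβ
  have s : c 0 • C.dir (v 0) + c 1 • C.dir (v 1) + c 2 • C.dir (v 2) = 0 := by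
    refine Prod.ext ?_ ?_
    · rw [map_add, map_add, map_smul, map_smul, map_smul] at pα; exact pα
    · rw [map_add, map_add, map_smul, map_smul, map_smul] at pβ; exact pβ
  have hneg : ∀ i, C.dir (v' i) = -C.dir (v i) := fun i =>
    ContactSystem.dir_opp (neg_sub _ _).symm
  have s' : c 0 • C.dir (v' 0) + c 1 • C.dir (v' 1) + c 2 • C.dir (v' 2) = 0 := by
    rw [hneg, hneg, hneg, smul_neg, smul_neg, smul_neg, ← neg_add, ← neg_add, s, neg_zero]
  have hy01 : (⟨y 0, hy 0⟩ : S) ≠ ⟨y 1, hy 1⟩ := fun e =>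
    hinj.ne (show (0 : Fin 3) ≠ 1 by decide) (congrArg Subtype.val e)
  -- Both cones of `x` surround the axis, which leaves `2n - 2` cones with a possible start and end.
  let T : Finset (S × Bool) := {(x', true), (x', false)}ᶜ
  have hT := C.card_le_two_mul_card T (by
    intro X hX u
    simp only [T, Finset.mem_compl, Finset.mem_insert, Finset.mem_singleton, not_not] at hX
    rcases hX with rfl | rfl
    · exact ContactSystem.not_isStart_isEnd (v₁ := v 0) (v₂ := v 1) (v₃ := v 2)
        (Or.inl rfl) (Or.inl rfl) (Or.inl rfl)
        (fun e => hy01 (congrArg (fun u : DiamDart S D => u.1.2) e)) (hc 0) (hc 1) (hc 2) s u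
    · exact ContactSystem.not_isStart_isEnd (v₁ := v' 0) (v₂ := v' 1) (v₃ := v' 2)
        (Or.inr rfl) (Or.inr rfl) (Or.inr rfl)
        (fun e => hy01 (congrArg (fun u : DiamDart S D => u.1.1) e)) (hc 0) (hc 1) (hc 2) s' u)
  have hcard : T.card = S.card * 2 - 2 := by
    rw [Finset.card_compl, Finset.card_pair (by simp)]
    simp
  have hpos := Finset.card_pos.2 ⟨x, hx⟩
  rw [Nat.card_eq_fintype_card]
  omega

/-- At most `4 * n - 4` ordered pairs of `n` points in three-dimensional space realize the
largest distance. -/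
theorem card_pairs_le (hdim : Module.finrank ℝ V = 3) (hD : 0 < D) (S : Finset V)
    (hS : ∀ x ∈ S, ∀ y ∈ S, dist x y ≤ D) (hne : S.Nonempty) :
    ((S ×ˢ S).filter fun q => dist q.1 q.2 = D).card + 4 ≤ 4 * S.card := by
  classical
  induction S using Finset.strongInduction with
  | H S ih =>
    by_cases hdeg : ∀ x ∈ S, 2 < (S.filter fun y => dist x y = D).card
    · refine le_trans (Nat.add_le_add_right ?_ 4) (card_diamDart_le_of_degree hdim hD hS hdeg hne)
      rw [Nat.card_eq_fintype_card, ← Finset.card_univ]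
      refine Finset.card_le_card_of_surjOn (fun u : DiamDart S D => ((u.1.1 : V), (u.1.2 : V))) ?_
      rintro ⟨a, b⟩ h
      simp only [Finset.coe_filter, Finset.mem_product, Set.mem_ofPred_eq] at h
      exact ⟨⟨(⟨a, h.1.1⟩, ⟨b, h.1.2⟩), h.2⟩, Finset.mem_coe.2 (Finset.mem_univ _), rfl⟩
    -- A point with at most two diameters accounts for at most four ordered pairs, which matches the
    -- decrease of `4 * S.card`.
    · push Not at hdeg
      obtain ⟨x, hx, hle⟩ := hdeg
      have h1 := card_pairs_erase_le S D x
      have h2 := Finset.card_erase_add_one hx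
      rcases (S.erase x).eq_empty_or_nonempty with h0 | h0
      · have : S = {x} := by rw [← Finset.insert_erase hx, h0]; rfl
        rw [this]
        simp [Finset.filter_singleton, hD.ne]
      · have := ih _ (Finset.erase_ssubset hx) (fun y hy z hz => hS y (Finset.mem_of_mem_erase hy)
          z (Finset.mem_of_mem_erase hz)) h0
        omega

end Diameters

theorem mainTheorem1 (n : ℕ) (hn : 4 ≤ n) (S : Finset (EuclideanSpace ℝ (Fin 3)))
    (hS : S.card = n) :
    (diameterGraph S).edgeSet.ncard ≤ 2 * n - 2 := by
  classical
  subst hS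
  have hle : ∀ x ∈ S, ∀ y ∈ S, dist x y ≤ Metric.diam (S : Set (EuclideanSpace ℝ (Fin 3))) :=
    fun x hx y hy => Metric.dist_le_diam_of_mem S.finite_toSet.isBounded hx hy
  obtain ⟨x, hx, y, hy, hxy⟩ := Finset.one_lt_card.1 (show 1 < S.card by omega)
  have hD := (dist_pos.2 hxy).trans_le (hle x hx y hy)
  have key := card_pairs_le (by simp) hD S hle ⟨x, hx⟩
  have h1 := (diameterGraph S).dart_card_eq_twice_card_edges
  have h2 : (diameterGraph S).edgeSet.ncard = (diameterGraph S).edgeFinset.card := by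
    rw [← SimpleGraph.coe_edgeFinset, Set.ncard_coe_finset]
  have h3 : Fintype.card (diameterGraph S).Dart ≤ ((S ×ˢ S).filter fun q =>
      dist q.1 q.2 = Metric.diam (S : Set (EuclideanSpace ℝ (Fin 3)))).card := by
    rw [← Finset.card_univ]
    refine Finset.card_le_card_of_injOn (fun d => (d.fst.1, d.snd.1)) ?_ ?_
    · intro d _
      simp only [Finset.coe_filter, Finset.mem_product, Set.mem_ofPred_eq]
      exact ⟨⟨d.fst.2, d.snd.2⟩, d.adj.2⟩
    · intro d _ d' _ e
      exact SimpleGraph.Dart.ext _ _ (Prod.ext (Subtype.ext (Prod.mk.inj e).1)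
        (Subtype.ext (Prod.mk.inj e).2))
  -- Each edge counts as two darts, so `4n - 4` ordered pairs give `2n - 2` edges.
  omega
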